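/- Let $n\ge 1$, let $\mathbb S^{d}(\mathbb C)=\{z\in\mathbb C^n: |z|=1\}$ with $d=2n-1$, let $\nu$ be its normalized surface measure, $\langle x,y\rangle=\sum_j x_j\overline{y_j}$, and let $\Delta$ be its (nonnegative) Laplace--Beltrami operator. For $k\ge 0$ let $\mathrm H_k$ be the space of smooth functions $f:\mathbb S^d(\mathbb C)\to\mathbb C$ with $\Delta f=k(k+d-1)f$. Fix $a\in\{0,1\}$ and put $\mathcal T_N=\mathrm{lin}\{\mathrm H_k: a\le k\le N\}$ (so that $a=0$ includes the constants and $a=1$ omits them). For a function $\Psi$ of one complex variable, the kernel $\kappa(x,y)=\Psi(\langle x,y\rangle)$ is called invariant, and $(\kappa * f)(x)=\int f(y)\,\Psi(\langle x,y\rangle)\,d\nu(y)$; we say that $\kappa$ lies in $\mathcal T_N$ if $\kappa(\cdot,e)\in\mathcal T_N$ for every $e\in\mathbb S^d(\mathbb C)$, and $\|\kappa\|_1\le C$ means that $\int|\kappa(x,e)|\,d\nu(x)\le C$ for every $e$. Define $\chi_0$ as the indicator function of $[0,1]$ and $\chi_s(t)=2d\int_t^{t+1/(2d)}\chi_{s-1}(u)\,du$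 for $1\le s\le d$. Then $\chi_d$ is $d-1$ times continuously differentiable, $\chi_d^{(d-1)}$ is Lipschitz continuous, $\chi_d\ge 0$ on $[0,\infty)$, $\chi_d=1$ on $[0,1/2]$, $\chi_d(t)=\frac{(2d)^d}{d!}(1-t)^d$ for $1-\frac1{2d}\le t\le 1$, and $\chi_d$ agrees with a polynomial of degree $d$ on each interval $[1-\frac{s}{2d},\,1-\frac{s-1}{2d}]$, $1\le s\le d$. Moreover, for every $k\ge0$ the space $\mathrm H_k$, with the scalar product of $L_2(\nu)$, has an invariant reproducing kernel $M_k$, and the kernels $$Q_{2N}=\sum_{k=a}^{2N}\chi_d\!\left(\frac{k}{2N}\right)M_k,\qquad N=1,2,\dots,$$ satisfy $Q_{2N}\in\mathcal T_{2N}$, $Q_{2N}*t_N=t_N$ for every $t_N\in\mathcal T_N$, and $\|Q_{2N}\|_1\le C$ for all $N\ge1$, with a constant $C$ that depends only on $n$. -/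

import Mathlib

open MeasureTheory
open scoped NNReal ContDiff InnerProductSpace

noncomputable section

namespace ComplexSphere

/-- The unit sphere of `ℂⁿ`, a real manifold of dimension `d = 2 * n - 1`. -/
abbrev CSphere (n : ℕ) : Type := Metric.sphere (0 : EuclideanSpace ℂ (Fin n)) 1

/-- The real dimension of the unit sphere of `ℂⁿ`. -/
def dim (n : ℕ) : ℕ := 2 * n - 1

/-- The normalized surface measure on the unit sphere of `ℂⁿ`. -/
def nu (n : ℕ) : Measure (CSphere n) :=
  let σ : Measure (CSphere n) := (volume : Measure (EuclideanSpace ℂ (Fin n))).toSphere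
  (σ Set.univ)⁻¹ • σ

/-- The Hermitian product `∑ j, w j * conj (z j)`, linear in the first argument. -/
def herm {n : ℕ} (w z : CSphere n) : ℂ :=
  inner ℂ (z : EuclideanSpace ℂ (Fin n)) (w : EuclideanSpace ℂ (Fin n))

/-- The extension of a function on the sphere to `ℂⁿ` that is constant on open rays from the
origin (with value `0` at the origin). -/
def radialExt {n : ℕ} (f : CSphere n → ℂ) (x : EuclideanSpace ℂ (Fin n)) : ℂ :=
  open Classical in
  if h : x = 0 then 0
  else f ⟨(‖x‖⁻¹ : ℝ) • x, by
    rw [mem_sphere_zero_iff_norm, norm_smul, norm_inv, norm_norm,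
      inv_mul_cancel₀ (norm_ne_zero_iff.2 h)]⟩

/-- Smoothness (in the real sense) of a function on the sphere. -/
def IsSmooth {n : ℕ} (f : CSphere n → ℂ) : Prop :=
  ContDiffOn ℝ ∞ (radialExt f) {0}ᶜ

/-- The (nonnegative) Laplace-Beltrami operator of the round metric: minus the Euclidean Laplacian
of `ℂⁿ = ℝ²ⁿ` applied to the extension that is constant along rays, restricted to the sphere. -/
def laplaceBeltrami {n : ℕ} (f : CSphere n → ℂ) (x : CSphere n) : ℂ :=
  -(Laplacian.laplacian (radialExt f) : EuclideanSpace ℂ (Fin n) → ℂ) x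

theorem radialExt_add {n : ℕ} (f g : CSphere n → ℂ) :
    radialExt (f + g) = radialExt f + radialExt g := by
  funext x
  by_cases h : x = 0 <;> simp [radialExt, h]

theorem radialExt_smul {n : ℕ} (c : ℂ) (f : CSphere n → ℂ) :
    radialExt (c • f) = c • radialExt f := by
  funext x
  by_cases h : x = 0 <;> simp [radialExt, h]

theorem radialExt_zero {n : ℕ} : radialExt (0 : CSphere n → ℂ) = fun _ => 0 := by
  funext x
  by_cases h : x = 0 <;> simp [radialExt, h]

theorem contDiffAt_of_isSmooth {n : ℕ} {f : CSphere n → ℂ} (hf : IsSmooth f) (x : CSphere n) :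
    ContDiffAt ℝ 2 (radialExt f) (x : EuclideanSpace ℂ (Fin n)) := by
  have hx : (x : EuclideanSpace ℂ (Fin n)) ≠ 0 := by
    intro h
    have := mem_sphere_zero_iff_norm.1 x.2
    rw [h, norm_zero] at this
    exact zero_ne_one this
  exact (ContDiffOn.contDiffAt hf (isOpen_compl_singleton.mem_nhds hx)).of_le
    (WithTop.coe_le_coe.2 le_top)

/-- The eigenvalue `θ_k = k (k + d - 1)` of the Laplace-Beltrami operator. -/
def theta (n k : ℕ) : ℝ := (k : ℝ) * ((k : ℝ) + (dim n : ℝ) - 1)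

/-- The eigenspace `H_k` of the Laplace-Beltrami operator for the eigenvalue `θ_k`. -/
def eigenspace (n k : ℕ) : Submodule ℂ (CSphere n → ℂ) where
  carrier := {f | IsSmooth f ∧ ∀ x, laplaceBeltrami f x = (theta n k : ℂ) * f x}
  zero_mem' := by
    refine ⟨?_, fun x => ?_⟩
    · unfold IsSmooth
      rw [radialExt_zero]
      exact contDiffOn_const
    · unfold laplaceBeltrami
      rw [radialExt_zero, InnerProductSpace.laplacian_const]
      simp
  add_mem' := by
    rintro f g ⟨hf, hf'⟩ ⟨hg, hg'⟩
    refine ⟨?_, fun x => ?_⟩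
    · unfold IsSmooth
      rw [radialExt_add]
      exact ContDiffOn.add hf hg
    · have h1 := hf' x
      have h2 := hg' x
      unfold laplaceBeltrami at h1 h2 ⊢
      rw [radialExt_add, (contDiffAt_of_isSmooth hf x).laplacian_add (contDiffAt_of_isSmooth hg x), neg_add, h1, h2,
        Pi.add_apply, mul_add]
  smul_mem' := by
    rintro c f ⟨hf, hf'⟩
    refine ⟨?_, fun x => ?_⟩
    · unfold IsSmooth
      rw [radialExt_smul]
      exact ContDiffOn.const_smul c hf
    · have h1 := hf' x
      unfold laplaceBeltrami at h1 ⊢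
      rw [radialExt_smul, InnerProductSpace.laplacian_smul c (contDiffAt_of_isSmooth hf x), ← smul_neg, h1,
        Pi.smul_apply, smul_eq_mul, smul_eq_mul]
      ring

/-- The space `lin {H_k : a ≤ k ≤ N}`. -/
def polySpace (n a N : ℕ) : Submodule ℂ (CSphere n → ℂ) :=
  ⨆ k ∈ Finset.Icc a N, eigenspace n k

/-- `K` is the reproducing kernel of the space `V` of functions on the sphere, with respect to the
scalar product of `L₂(ν)`. -/
def IsReproducingKernel {n : ℕ} (V : Submodule ℂ (CSphere n → ℂ))
    (K : CSphere n → CSphere n → ℂ) : Prop :=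
  (∀ y, (fun x => K x y) ∈ V) ∧
    ∀ f ∈ V, ∀ y, f y = ∫ x, f x * (starRingEnd ℂ) (K x y) ∂(nu n)

/-- The unitarily invariant kernel `(x, y) ↦ Ψ ⟨x, y⟩` with profile `Ψ`. -/
def invKernel {n : ℕ} (Ψ : ℂ → ℂ) (x y : CSphere n) : ℂ := Ψ (herm x y)

/-- The convolution of the invariant kernel with profile `Ψ` and a function on the sphere. -/
def conv {n : ℕ} (Ψ : ℂ → ℂ) (f : CSphere n → ℂ) (x : CSphere n) : ℂ :=
  ∫ y, f y * invKernel Ψ x y ∂(nu n)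

/-- The functions `χ_s`, `s = 0, 1, 2, …`: the indicator function of `[0, 1]` averaged `s` times
over a window of length `1 / (2 * d)` to the right. -/
def cutoff (d : ℕ) : ℕ → ℝ → ℝ
  | 0 => Set.indicator (Set.Icc 0 1) (fun _ => 1)
  | s + 1 => fun t => 2 * (d : ℝ) * ∫ u in t..(t + 1 / (2 * (d : ℝ))), cutoff d s u

/-- The profile of `∑ k ∈ [a, 2N], χ_d (k / (2N)) * M_k`, where `M k` is the profile of an
invariant kernel and `d` is the dimension of the sphere of `ℂⁿ`. -/
def vpKernel (n : ℕ) (M : ℕ → ℂ → ℂ) (a N : ℕ) : ℂ → ℂ := fun w =>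
  ∑ k ∈ Finset.Icc a (2 * N),
    (cutoff (dim n) (dim n) ((k : ℝ) / (2 * (N : ℝ))) : ℂ) * M k w

/-- The properties of the cutoff function `χ_d`: it is `d - 1` times continuously differentiable
with Lipschitz derivative of order `d - 1`, nonnegative, equal to `1` on `[0, 1/2]`, equal to an
explicit power on the last interval, and a polynomial of degree `d` on each of the `d` intervals of
length `1 / (2 * d)` that make up `[1/2, 1]`. -/
structure IsSmoothCutoff (d : ℕ) (χ : ℝ → ℝ) : Prop where
  contDiff : ContDiff ℝ ((d - 1 : ℕ) : ℕ∞) χ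
  lipschitz : ∃ L : ℝ≥0, LipschitzWith L (iteratedDeriv (d - 1) χ)
  nonneg : ∀ t, 0 ≤ t → 0 ≤ χ t
  eq_one : ∀ t ∈ Set.Icc (0 : ℝ) (1 / 2), χ t = 1
  eq_pow : ∀ t ∈ Set.Icc (1 - 1 / (2 * (d : ℝ))) 1,
    χ t = (2 * (d : ℝ)) ^ d / (d.factorial : ℝ) * (1 - t) ^ d
  eq_poly : ∀ s ∈ Finset.Icc 1 d, ∃ p : Polynomial ℝ, p.natDegree = d ∧
    ∀ t ∈ Set.Icc (1 - (s : ℝ) / (2 * (d : ℝ))) (1 - ((s : ℝ) - 1) / (2 * (d : ℝ))),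
      χ t = p.eval t

end ComplexSphere

end

/-! With `d = 2 * l + 1`, the zonal polynomials are generated by the Poisson kernel
`(1 - r²) / (1 - 2 a r + r²) ^ (l + 1)`, where `a = Re ⟨x, y⟩`. Multiplying by `(1 - r) ^ (-d - 1)`
gives the generating function of the Cesàro kernels of order `d`, which factors into power series
with nonnegative coefficients. So these kernels are nonnegative, and their `L₁` norms are their
means, which are binomial coefficients. Summing `Q_{2N}` by parts `d + 1` times expresses it through
the Cesàro kernels, with the differences of order `d + 1` of `χ_d (k / (2N))` as coefficients. The
total variation of the differences of order `d` is `O(N ^ (-d))`, because `χ_d` is a `d`-fold moving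
average of an indicator function, and this compensates the growth of the binomial coefficients.

Eigenfunctions with different eigenvalues are orthogonal by the Green identity, applied in an
annulus to functions constant on rays. The zonal polynomials are eigenfunctions by the Gegenbauer
equation. Hence convolving an eigenfunction with a Cesàro kernel leaves one term, and since the
normalized Cesàro kernels form an approximate identity, that term is the eigenfunction itself. -/

noncomputable section

namespace ComplexSphere

open Finset Polynomial
open scoped PowerSeries Laplacian

/-! ### The cutoff function -/

theorem fwdDiff_comm {M G : Type*} [AddCommMonoid M] [AddCommGroup G] (g h : M) (f : M → G) :
    fwdDiff g (fwdDiff h f) = fwdDiff h (fwdDiff g f) := by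
  funext t
  simp only [fwdDiff, add_right_comm t h g]
  abel

theorem intervalIntegrable_fwdDiff_iter {E : Type*} [NormedAddCommGroup E] {f : ℝ → E}
    (hf : ∀ a b, IntervalIntegrable f volume a b) (h : ℝ) (s : ℕ) (a b : ℝ) :
    IntervalIntegrable ((fwdDiff h)^[s] f) volume a b := by
  induction s generalizing f with
  | zero => exact hf a b
  | succ _ ih =>
    refine ih fun a b => IntervalIntegrable.sub ?_ (hf a b)
    simpa using (hf (a + h) (b + h)).comp_add_right h

theorem lipschitzWith_fwdDiff {E : Type*} [NormedAddCommGroup E] {f : ℝ → E} {L : ℝ≥0}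
    (hf : LipschitzWith L f) (h : ℝ) :
    LipschitzWith (L + L) (fwdDiff h f) := by
  have hshift : LipschitzWith (L * 1) fun t => f (t + h) :=
    hf.comp (LipschitzWith.of_dist_le_mul fun x y => by simp)
  simpa only [mul_one] using! hshift.sub hf

section SlidingIntegral

variable {E : Type*} [NormedAddCommGroup E] [NormedSpace ℝ E]

/-- The integral of `f` over the window of length `h` to the right of `t`, as a function of `t`.
The cutoff functions are obtained by iterating it, and it turns smoothness and variation bounds of
`f` into those of one order more. -/
def slidingIntegral (h : ℝ) (f : ℝ → E) (t : ℝ) : E := ∫ u in t..(t + h), f u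

theorem integral_fwdDiff_iter {f F : ℝ → E} (hf : ∀ a b, IntervalIntegrable f volume a b)
    (hF : ∀ a b, ∫ u in a..b, f u = F b - F a) (h : ℝ) (s : ℕ) (a b : ℝ) :
    ∫ u in a..b, (fwdDiff h)^[s] f u = (fwdDiff h)^[s] F b - (fwdDiff h)^[s] F a := by
  induction s generalizing f F with
  | zero => exact hF a b
  | succ _ ih =>
    refine ih (intervalIntegrable_fwdDiff_iter hf h 1) fun a b => ?_
    have hshift : IntervalIntegrable (fun u => f (u + h)) volume a b := by
      simpa using (hf (a + h) (b + h)).comp_add_right h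
    simp only [fwdDiff]
    rw [intervalIntegral.integral_sub hshift (hf a b), intervalIntegral.integral_comp_add_right,
      hF, hF]
    abel

theorem slidingIntegral_eq_fwdDiff {f : ℝ → E} (hf : ∀ a b, IntervalIntegrable f volume a b)
    (h : ℝ) : slidingIntegral h f = fwdDiff h fun t => ∫ u in (0 : ℝ)..t, f u :=
  funext fun _ => (intervalIntegral.integral_interval_sub_left (hf _ _) (hf _ _)).symm

theorem lipschitzWith_slidingIntegral {f : ℝ → E} (hf : ∀ a b, IntervalIntegrable f volume a b)
    {C : ℝ≥0} (hC : ∀ t, ‖f t‖ ≤ C) (h : ℝ) : LipschitzWith (C + C) (slidingIntegral h f) := by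
  rw [slidingIntegral_eq_fwdDiff hf]
  refine lipschitzWith_fwdDiff (LipschitzWith.of_dist_le_mul fun x y => ?_) h
  rw [dist_eq_norm, intervalIntegral.integral_interval_sub_left (hf _ _) (hf _ _), Real.dist_eq]
  exact intervalIntegral.norm_integral_le_of_norm_le_const fun u _ => hC u

theorem hasDerivAt_slidingIntegral [CompleteSpace E] {f : ℝ → E} (hf : Continuous f) (h t : ℝ) :
    HasDerivAt (slidingIntegral h f) (fwdDiff h f t) t := by
  rw [slidingIntegral_eq_fwdDiff fun a b => hf.intervalIntegrable a b]
  have hprim (x : ℝ) : HasDerivAt (fun t => ∫ u in (0 : ℝ)..t, f u) (f x) x :=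
    (hf.integral_hasStrictDerivAt 0 x).hasDerivAt
  exact ((hprim (t + h)).comp_add_const t h).sub (hprim t)

theorem contDiff_fwdDiff {f : ℝ → E} {m : ℕ∞} (hf : ContDiff ℝ m f) (h : ℝ) :
    ContDiff ℝ m (fwdDiff h f) :=
  (hf.comp (contDiff_id.add contDiff_const)).sub hf

theorem contDiff_slidingIntegral [CompleteSpace E] {f : ℝ → E} {m : ℕ} (hf : ContDiff ℝ m f)
    (h : ℝ) : ContDiff ℝ (m + 1 : ℕ) (slidingIntegral h f) := by
  rw [Nat.cast_add, Nat.cast_one, contDiff_succ_iff_deriv]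
  refine ⟨fun t => (hasDerivAt_slidingIntegral hf.continuous h t).differentiableAt, by simp, ?_⟩
  rw [funext fun t => (hasDerivAt_slidingIntegral hf.continuous h t).deriv]
  exact contDiff_fwdDiff (m := m) hf h

theorem iteratedDeriv_slidingIntegral [CompleteSpace E] {f : ℝ → E} {m : ℕ}
    (hf : ContDiff ℝ m f) (h : ℝ) :
    iteratedDeriv (m + 1) (slidingIntegral h f) = fwdDiff h (iteratedDeriv m f) := by
  rw [iteratedDeriv_succ', funext fun t => (hasDerivAt_slidingIntegral hf.continuous h t).deriv]
  funext t
  have hshift : ContDiff ℝ m fun t => f (t + h) := hf.comp (contDiff_id.add contDiff_const)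
  unfold fwdDiff
  rw [iteratedDeriv_fun_sub hshift.contDiffAt hf.contDiffAt, iteratedDeriv_comp_add_const]

theorem sum_norm_integral_shift_le {f : ℝ → E} (hf : ∀ a b, IntervalIntegrable f volume a b)
    {δ V t : ℝ} {K : ℕ} (hδ : 0 ≤ δ) (hV : ∀ u, t ≤ u → ∑ k ∈ range K, ‖f (u + k * δ)‖ ≤ V) :
    ∑ k ∈ range K, ‖∫ u in (t + k * δ)..(t + k * δ + δ), f u‖ ≤ δ * V := by
  have hshift (k : ℕ) : IntervalIntegrable (fun u => f (u + k * δ)) volume t (t + δ) := by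
    simpa using (hf (t + k * δ) (t + δ + k * δ)).comp_add_right (k * δ)
  have hle : t ≤ t + δ := by linarith
  calc ∑ k ∈ range K, ‖∫ u in (t + k * δ)..(t + k * δ + δ), f u‖
      ≤ ∑ k ∈ range K, ∫ u in t..(t + δ), ‖f (u + k * δ)‖ := by
        refine sum_le_sum fun k _ => ?_
        rw [add_right_comm, ← intervalIntegral.integral_comp_add_right]
        exact intervalIntegral.norm_integral_le_integral_norm hle
    _ = ∫ u in t..(t + δ), ∑ k ∈ range K, ‖f (u + k * δ)‖ :=
        (intervalIntegral.integral_finsetSum fun k _ => (hshift k).norm).symm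
    _ ≤ ∫ _ in t..(t + δ), V := by
        refine intervalIntegral.integral_mono_on hle ?_ intervalIntegrable_const
          fun u hu => hV u hu.1
        simpa only [sum_fn] using IntervalIntegrable.sum _ fun k _ => (hshift k).norm
    _ = δ * V := by simp

-- Differences with step `δ` commute with those with step `h`, so that a difference of the sliding
-- integral over the long window `h` is one over the short window `δ`.
theorem sum_norm_fwdDiff_iter_slidingIntegral_le {f : ℝ → E}
    (hf : ∀ a b, IntervalIntegrable f volume a b) {h δ V : ℝ} (hh : 0 ≤ h) (hδ : 0 ≤ δ) {s K : ℕ}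
    (hV : ∀ t, 0 ≤ t → ∑ k ∈ range K, ‖(fwdDiff δ)^[s] f (t + k * δ)‖ ≤ V) {t : ℝ} (ht : 0 ≤ t) :
    ∑ k ∈ range K, ‖(fwdDiff δ)^[s + 1] (slidingIntegral h f) (t + k * δ)‖ ≤ 2 * δ * V := by
  set I : ℝ → E := slidingIntegral δ ((fwdDiff δ)^[s] f)
  have hswap : (fwdDiff δ)^[s + 1] (slidingIntegral h f) = fwdDiff h I := by
    have hI : I = (fwdDiff δ)^[s + 1] fun t => ∫ u in (0 : ℝ)..t, f u := by
      funext t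
      rw [Function.iterate_succ_apply']
      exact integral_fwdDiff_iter hf
        (fun a b => (intervalIntegral.integral_interval_sub_left (hf _ _) (hf _ _)).symm) δ s _ _
    rw [hI, slidingIntegral_eq_fwdDiff hf]
    exact Function.Commute.iterate_left (fwdDiff_comm δ h) (s + 1) _
  have hI {t : ℝ} (ht : 0 ≤ t) : ∑ k ∈ range K, ‖I (t + k * δ)‖ ≤ δ * V :=
    sum_norm_integral_shift_le (intervalIntegrable_fwdDiff_iter hf δ s) hδ
      fun u hu => hV u (ht.trans hu)
  calc ∑ k ∈ range K, ‖(fwdDiff δ)^[s + 1] (slidingIntegral h f) (t + k * δ)‖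
      ≤ ∑ k ∈ range K, (‖I (t + h + k * δ)‖ + ‖I (t + k * δ)‖) := by
        refine sum_le_sum fun k _ => ?_
        rw [hswap, fwdDiff, add_right_comm]
        exact norm_sub_le _ _
    _ ≤ δ * V + δ * V := by
        rw [sum_add_distrib]
        exact add_le_add (hI (add_nonneg ht hh)) (hI ht)
    _ = 2 * δ * V := by ring

end SlidingIntegral

/-- The truncated power `x ↦ x₊ ^ s`, equal to the indicator function of `[0, ∞)` for `s = 0`. The
cutoff functions are combinations of its reflected translates. -/
def truncPow (s : ℕ) (x : ℝ) : ℝ := if 0 ≤ x then x ^ s else 0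

theorem truncPow_of_nonneg (s : ℕ) {x : ℝ} (hx : 0 ≤ x) : truncPow s x = x ^ s := if_pos hx

theorem truncPow_of_neg (s : ℕ) {x : ℝ} (hx : x < 0) : truncPow s x = 0 := if_neg hx.not_ge

theorem truncPow_of_nonpos {s : ℕ} (hs : s ≠ 0) {x : ℝ} (hx : x ≤ 0) : truncPow s x = 0 := by
  rcases hx.lt_or_eq with h | rfl
  · exact truncPow_of_neg s h
  · simp [truncPow, hs]

theorem monotone_truncPow (s : ℕ) : Monotone (truncPow s) := by
  intro x y hxy
  rcases lt_or_ge x 0 with hx | hx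
  · rw [truncPow_of_neg s hx, truncPow]
    split_ifs with hy
    exacts [pow_nonneg hy s, le_rfl]
  · rw [truncPow_of_nonneg s hx, truncPow_of_nonneg s (hx.trans hxy)]
    gcongr

theorem integral_truncPow (s : ℕ) (a b : ℝ) :
    ∫ u in a..b, truncPow s u = (truncPow (s + 1) b - truncPow (s + 1) a) / (s + 1) := by
  have hint (a b : ℝ) : IntervalIntegrable (truncPow s) volume a b :=
    (monotone_truncPow s).intervalIntegrable
  have hzero (b : ℝ) : ∫ u in (0 : ℝ)..b, truncPow s u = truncPow (s + 1) b / (s + 1) := by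
    rcases le_or_gt 0 b with hb | hb
    · rw [intervalIntegral.integral_congr (g := fun u => u ^ s) fun u hu => ?_, integral_pow,
        truncPow_of_nonneg _ hb, zero_pow s.succ_ne_zero, sub_zero]
      rw [Set.uIcc_of_le hb] at hu
      exact truncPow_of_nonneg s hu.1
    · rw [truncPow_of_neg _ hb, zero_div, intervalIntegral.integral_symm,
        intervalIntegral.integral_of_le hb.le, integral_Ioc_eq_integral_Ioo,
        setIntegral_eq_zero_of_forall_eq_zero fun u hu => truncPow_of_neg s hu.2, neg_zero]
  rw [← intervalIntegral.integral_interval_sub_left (hint 0 b) (hint 0 a), hzero, hzero, sub_div]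

theorem integral_truncPow_one_sub (s : ℕ) (a b : ℝ) :
    ∫ u in a..b, truncPow s (1 - u) =
      -(s + 1 : ℝ)⁻¹ * truncPow (s + 1) (1 - b) - -(s + 1 : ℝ)⁻¹ * truncPow (s + 1) (1 - a) := by
  rw [intervalIntegral.integral_comp_sub_left (truncPow s), integral_truncPow]
  ring

theorem cutoff_succ (d s : ℕ) :
    cutoff d (s + 1) = (2 * (d : ℝ)) • slidingIntegral (1 / (2 * d)) (cutoff d s) := rfl

theorem cutoff_eq_fwdDiff (d s : ℕ) {t : ℝ} (ht : 0 ≤ t) :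
    cutoff d s t = (-1) ^ s * ((2 * d : ℝ) ^ s / s.factorial) *
      (fwdDiff (1 / (2 * d : ℝ)))^[s] (fun u => truncPow s (1 - u)) t := by
  induction s generalizing t with
  | zero => by_cases h : t ≤ 1 <;> simp [cutoff, truncPow, h, ht]
  | succ s ih =>
    set h : ℝ := 1 / (2 * d)
    have hh : 0 ≤ h := by positivity
    have hint (a b : ℝ) : IntervalIntegrable (fun u => truncPow s (1 - u)) volume a b :=
      Antitone.intervalIntegrable fun u v huv => monotone_truncPow s (by linarith)
    have hprim := integral_fwdDiff_iter hint (integral_truncPow_one_sub s)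
      (F := -(s + 1 : ℝ)⁻¹ • fun u => truncPow (s + 1) (1 - u)) h s t (t + h)
    calc cutoff d (s + 1) t = 2 * d * ∫ u in t..(t + h), cutoff d s u := rfl
      _ = 2 * d * ∫ u in t..(t + h), (-1) ^ s * ((2 * d : ℝ) ^ s / s.factorial) *
          (fwdDiff h)^[s] (fun u => truncPow s (1 - u)) u := by
        congr 1
        refine intervalIntegral.integral_congr fun u hu => ih ?_
        rw [Set.uIcc_of_le (by linarith)] at hu
        exact ht.trans hu.1
      _ = _ := by
        rw [intervalIntegral.integral_const_mul, hprim, fwdDiff_iter_const_smul,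
          Function.iterate_succ_apply' (fwdDiff h), fwdDiff, Nat.factorial_succ]
        simp only [Pi.smul_apply, smul_eq_mul]
        push_cast
        field_simp
        ring

theorem cutoff_eq_sum (d s : ℕ) {t : ℝ} (ht : 0 ≤ t) :
    cutoff d s t = (2 * d : ℝ) ^ s / s.factorial *
      ∑ k ∈ range (s + 1), (-1) ^ k * (s.choose k : ℝ) * truncPow s (1 - k / (2 * d) - t) := by
  rw [cutoff_eq_fwdDiff d s ht, fwdDiff_iter_eq_sum_shift, mul_comm ((-1 : ℝ) ^ s), mul_assoc,
    mul_sum]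
  congr 1
  refine sum_congr rfl fun k hk => ?_
  obtain ⟨j, rfl⟩ := Nat.exists_eq_add_of_le (Nat.lt_succ_iff.1 (mem_range.1 hk))
  rw [zsmul_eq_mul, nsmul_eq_mul, Nat.add_sub_cancel_left, pow_add]
  push_cast
  rw [show 1 - (t + k * (1 / (2 * (d : ℝ)))) = 1 - k / (2 * d) - t by ring]
  linear_combination (-1 : ℝ) ^ k * ((k + j).choose k) * truncPow (k + j) (1 - k / (2 * d) - t) *
    (even_two_mul j).neg_one_pow (α := ℝ)

theorem cutoff_eq_zero (d : ℕ) {s : ℕ} (hs : s ≠ 0) {t : ℝ} (ht : 1 ≤ t) : cutoff d s t = 0 := by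
  rw [cutoff_eq_sum d s (by linarith), sum_eq_zero, mul_zero]
  intro k _
  have : 0 ≤ (k : ℝ) / (2 * d) := by positivity
  rw [truncPow_of_nonpos hs (by linarith), mul_zero]

theorem cutoff_nonneg (d s : ℕ) (t : ℝ) : 0 ≤ cutoff d s t := by
  induction s generalizing t with
  | zero => exact Set.indicator_nonneg (fun _ _ => zero_le_one) t
  | succ s ih =>
    refine mul_nonneg (by positivity) (intervalIntegral.integral_nonneg ?_ fun u _ => ih u)
    exact le_add_of_nonneg_right (by positivity)

theorem cutoff_eq_one {d : ℕ} (hd : 0 < d) (s : ℕ) {t : ℝ} (ht : 0 ≤ t)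
    (ht' : t ≤ 1 - s * (1 / (2 * d))) : cutoff d s t = 1 := by
  induction s generalizing t with
  | zero => exact Set.indicator_of_mem (by simpa [ht] using ht') _
  | succ s ih =>
    set h : ℝ := 1 / (2 * d)
    have hh : 0 ≤ h := by positivity
    have hone : ∫ u in t..(t + h), cutoff d s u = ∫ _ in t..(t + h), (1 : ℝ) := by
      refine intervalIntegral.integral_congr fun u hu => ih ?_ ?_ <;>
        rw [Set.uIcc_of_le (by linarith)] at hu <;> push_cast at ht' <;> linarith [hu.1, hu.2]
    calc cutoff d (s + 1) t = 2 * d * ∫ u in t..(t + h), cutoff d s u := rfl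
      _ = 2 * d * h := by rw [hone]; simp
      _ = 1 := mul_one_div_cancel (by positivity)

theorem intervalIntegrable_cutoff_zero (d : ℕ) (a b : ℝ) :
    IntervalIntegrable (cutoff d 0) volume a b :=
  ((integrable_indicator_iff measurableSet_Icc).2
    (integrableOn_const (by simp))).intervalIntegrable

theorem exists_lipschitzWith_cutoff_one (d : ℕ) : ∃ L : ℝ≥0, LipschitzWith L (cutoff d 1) := by
  have hbound (t : ℝ) : ‖cutoff d 0 t‖ ≤ (1 : ℝ≥0) := by
    simpa using! norm_indicator_le_norm_self (s := Set.Icc 0 1) (fun _ => (1 : ℝ)) t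
  exact ⟨_, (lipschitzWith_smul (2 * (d : ℝ))).comp
    (lipschitzWith_slidingIntegral (intervalIntegrable_cutoff_zero d) hbound _)⟩

theorem contDiff_cutoff (d s : ℕ) : ContDiff ℝ s (cutoff d (s + 1)) := by
  induction s with
  | zero =>
    obtain ⟨L, hL⟩ := exists_lipschitzWith_cutoff_one d
    exact contDiff_zero.2 hL.continuous
  | succ s ih => exact (contDiff_slidingIntegral ih _).const_smul (2 * (d : ℝ))

theorem intervalIntegrable_cutoff (d s : ℕ) (a b : ℝ) :
    IntervalIntegrable (cutoff d s) volume a b := by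
  cases s with
  | zero => exact intervalIntegrable_cutoff_zero d a b
  | succ s => exact (contDiff_cutoff d s).continuous.intervalIntegrable a b

theorem exists_lipschitzWith_iteratedDeriv_cutoff (d s : ℕ) :
    ∃ L : ℝ≥0, LipschitzWith L (iteratedDeriv s (cutoff d (s + 1))) := by
  induction s with
  | zero =>
    rw [iteratedDeriv_zero]
    exact exists_lipschitzWith_cutoff_one d
  | succ s ih =>
    obtain ⟨L, hL⟩ := ih
    have hder : iteratedDeriv (s + 1) (cutoff d (s + 2)) =
        (2 * (d : ℝ)) • fwdDiff (1 / (2 * (d : ℝ))) (iteratedDeriv s (cutoff d (s + 1))) := by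
      rw [cutoff_succ d (s + 1), ← iteratedDeriv_slidingIntegral (contDiff_cutoff d s)]
      funext t
      exact iteratedDeriv_const_smul_field _ _
    rw [hder]
    exact ⟨_, (lipschitzWith_smul (2 * (d : ℝ))).comp (lipschitzWith_fwdDiff hL _)⟩

/-- The polynomial that agrees with `cutoff d d` on `[1 - s / (2 * d), 1 - (s - 1) / (2 * d)]`: the
truncated powers that do not vanish on this interval, with the truncation omitted. -/
def cutoffPiece (d s : ℕ) : ℝ[X] :=
  C ((2 * d : ℝ) ^ d / d.factorial) *
    ∑ k ∈ range s, C ((-1) ^ k * (d.choose k : ℝ)) * (C (1 - k / (2 * d) : ℝ) - X) ^ d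

theorem sum_range_alternating_choose_ne_zero {d s : ℕ} (hs : 1 ≤ s) (hsd : s ≤ d) :
    ∑ k ∈ range s, (-1 : ℝ) ^ k * (d.choose k : ℝ) ≠ 0 := by
  obtain ⟨e, rfl⟩ := Nat.exists_eq_add_of_le' (hs.trans hsd)
  obtain ⟨r, rfl⟩ := Nat.exists_eq_add_of_le' hs
  have hsum : ∑ k ∈ range (r + 1), (-1 : ℝ) ^ k * ((e + 1).choose k : ℝ) =
      (-1) ^ r * (e.choose r : ℝ) := by
    exact_mod_cast Int.alternating_sum_range_choose_eq_choose (n := e) (m := r)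
  rw [hsum]
  exact mul_ne_zero (by positivity) (Nat.cast_ne_zero.2 (Nat.choose_pos (by lia)).ne')

theorem natDegree_cutoffPiece {d s : ℕ} (hs : 1 ≤ s) (hsd : s ≤ d) :
    (cutoffPiece d s).natDegree = d := by
  have hd : 0 < d := hs.trans hsd
  have hlin (a : ℝ) : (C a - X).natDegree ≤ 1 := (natDegree_sub_le _ _).trans (by simp)
  have hdeg (a : ℝ) : ((C a - X) ^ d).natDegree ≤ d := by
    simpa using natDegree_pow_le_of_le d (hlin a)
  have hcoeff (a : ℝ) : ((C a - X) ^ d).coeff d = (-1) ^ d := by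
    simpa using coeff_pow_of_natDegree_le (m := d) (hlin a)
  refine natDegree_eq_of_le_of_coeff_ne_zero ?_ ?_
  · refine (natDegree_C_mul_le _ _).trans (natDegree_sum_le_of_forall_le _ _ fun k _ => ?_)
    exact (natDegree_C_mul_le _ _).trans (hdeg _)
  · simp only [cutoffPiece, coeff_C_mul, finsetSum_coeff, hcoeff, ← sum_mul]
    exact mul_ne_zero (by positivity)
      (mul_ne_zero (sum_range_alternating_choose_ne_zero hs hsd) (by positivity))

theorem cutoff_eq_eval_cutoffPiece {d s : ℕ} (hs : 1 ≤ s) (hsd : s ≤ d) {t : ℝ}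
    (ht : t ∈ Set.Icc (1 - (s : ℝ) / (2 * d)) (1 - ((s : ℝ) - 1) / (2 * d))) :
    cutoff d d t = (cutoffPiece d s).eval t := by
  have hd : 0 < (d : ℝ) := by exact_mod_cast hs.trans hsd
  have ht0 : 0 ≤ t := by
    have : (s : ℝ) / (2 * d) ≤ 1 := (div_le_one (by positivity)).2 (by norm_cast; lia)
    linarith [ht.1]
  rw [cutoff_eq_sum d d ht0, cutoffPiece, eval_mul, eval_C, eval_finsetSum]
  congr 1
  symm
  refine (sum_congr rfl fun k hk => ?_).trans
    (sum_subset (range_subset_range.2 (by lia : s ≤ d + 1)) fun k _ hk => ?_)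
  · have : (k : ℝ) / (2 * d) ≤ (s - 1) / (2 * d) := by
      gcongr
      rw [le_sub_iff_add_le]
      exact_mod_cast mem_range.1 hk
    rw [truncPow_of_nonneg _ (by linarith [ht.2])]
    simp
  · have : (s : ℝ) / (2 * d) ≤ k / (2 * d) := by
      gcongr
      simpa using hk
    rw [truncPow_of_nonpos (by lia) (by linarith [ht.1]), mul_zero]

theorem isSmoothCutoff_cutoff {d : ℕ} (hd : 0 < d) : IsSmoothCutoff d (cutoff d d) where
  contDiff := by
    have h := contDiff_cutoff d (d - 1)
    rwa [Nat.sub_add_cancel hd] at h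
  lipschitz := by
    simpa [Nat.sub_add_cancel hd] using exists_lipschitzWith_iteratedDeriv_cutoff d (d - 1)
  nonneg t _ := cutoff_nonneg d d t
  eq_one t ht := cutoff_eq_one hd d ht.1 (ht.2.trans_eq (by field_simp; norm_num))
  eq_pow t ht := by
    rw [cutoff_eq_eval_cutoffPiece le_rfl hd (by simpa using ht)]
    simp [cutoffPiece]
  eq_poly s hs := ⟨cutoffPiece d s, natDegree_cutoffPiece (mem_Icc.1 hs).1 (mem_Icc.1 hs).2,
    fun _ => cutoff_eq_eval_cutoffPiece (mem_Icc.1 hs).1 (mem_Icc.1 hs).2⟩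

theorem sum_abs_fwdDiff_cutoff_zero_le (d K : ℕ) {δ t : ℝ} (hδ : 0 ≤ δ) (ht : 0 ≤ t) :
    ∑ k ∈ range K, ‖fwdDiff δ (cutoff d 0) (t + k * δ)‖ ≤ 1 := by
  have hanti {x y : ℝ} (hx : 0 ≤ x) (hxy : x ≤ y) : cutoff d 0 y ≤ cutoff d 0 x := by
    simp only [cutoff, Set.indicator, Set.mem_Icc]
    split_ifs <;> grind
  have hle : cutoff d 0 t ≤ 1 := Set.indicator_le_self' (fun _ _ => zero_le_one) t
  calc ∑ k ∈ range K, ‖fwdDiff δ (cutoff d 0) (t + k * δ)‖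
      = ∑ k ∈ range K, (cutoff d 0 (t + k * δ) - cutoff d 0 (t + (k + 1 : ℕ) * δ)) := by
        refine sum_congr rfl fun k _ => ?_
        rw [fwdDiff, Nat.cast_succ, show t + k * δ + δ = t + (k + 1) * δ by ring, Real.norm_eq_abs,
          abs_sub_comm, abs_of_nonneg]
        refine sub_nonneg.2 (hanti (by positivity) ?_)
        gcongr
        linarith
    _ ≤ 1 := by
        rw [sum_range_sub' fun k : ℕ => cutoff d 0 (t + k * δ), Nat.cast_zero, zero_mul, add_zero]
        linarith [cutoff_nonneg d 0 (t + K * δ)]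

theorem sum_abs_fwdDiff_cutoff_le (d s K : ℕ) {δ t : ℝ} (hδ : 0 ≤ δ) (ht : 0 ≤ t) :
    ∑ k ∈ range K, ‖(fwdDiff δ)^[s + 1] (cutoff d s) (t + k * δ)‖ ≤ (4 * d * δ) ^ s := by
  induction s generalizing t with
  | zero => simpa using sum_abs_fwdDiff_cutoff_zero_le d K hδ ht
  | succ s ih =>
    have h := sum_norm_fwdDiff_iter_slidingIntegral_le (intervalIntegrable_cutoff d s)
      (h := 1 / (2 * (d : ℝ))) (by positivity) hδ (fun _ => ih) ht
    calc ∑ k ∈ range K, ‖(fwdDiff δ)^[s + 2] (cutoff d (s + 1)) (t + k * δ)‖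
        = 2 * d * ∑ k ∈ range K, ‖(fwdDiff δ)^[s + 2]
            (slidingIntegral (1 / (2 * d)) (cutoff d s)) (t + k * δ)‖ := by
          rw [cutoff_succ, mul_sum]
          refine sum_congr rfl fun k _ => ?_
          rw [fwdDiff_iter_const_smul, Pi.smul_apply, norm_smul,
            Real.norm_of_nonneg (by positivity)]
      _ ≤ 2 * d * (2 * δ * (4 * d * δ) ^ s) := by gcongr
      _ = (4 * d * δ) ^ (s + 1) := by ring

theorem fwdDiff_iter_comp_natCast_mul {E : Type*} [AddCommGroup E] (f : ℝ → E) (δ : ℝ) (s k : ℕ) :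
    (fwdDiff 1)^[s] (fun k : ℕ => f (k * δ)) k = (fwdDiff δ)^[s] f (k * δ) := by
  simp only [fwdDiff_iter_eq_sum_shift, nsmul_eq_mul, mul_one, Nat.cast_add, add_mul, Nat.cast_id]

theorem sum_abs_fwdDiff_cutoff_div_mul_choose_le (d : ℕ) {R : ℕ} (hR : 0 < R) :
    ∑ k ∈ range (R + 1), |(fwdDiff 1)^[d + 1] (fun k : ℕ => cutoff d d (k / R)) k| *
      ((d + k).choose d : ℝ) ≤ (4 * d * (d + 1)) ^ d := by
  have hR1 : (1 : ℝ) ≤ R := by exact_mod_cast hR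
  have hchoose {k : ℕ} (hk : k ∈ range (R + 1)) :
      ((d + k).choose d : ℝ) ≤ ((d + 1) * R) ^ d := by
    have hkR : (k : ℝ) ≤ R := by exact_mod_cast Nat.lt_succ_iff.1 (mem_range.1 hk)
    calc ((d + k).choose d : ℝ) ≤ ((d + k : ℕ) : ℝ) ^ d := by
          exact_mod_cast Nat.choose_le_pow (d + k) d
      _ ≤ ((d + 1) * R) ^ d := by
          push_cast
          gcongr
          nlinarith [(d.cast_nonneg : (0 : ℝ) ≤ d)]
  calc ∑ k ∈ range (R + 1), |(fwdDiff 1)^[d + 1] (fun k : ℕ => cutoff d d (k / R)) k| *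
          ((d + k).choose d : ℝ)
      ≤ ∑ k ∈ range (R + 1), ‖(fwdDiff (R : ℝ)⁻¹)^[d + 1] (cutoff d d) (0 + k * (R : ℝ)⁻¹)‖ *
          ((d + 1) * R) ^ d := by
        refine sum_le_sum fun k hk => ?_
        simp only [div_eq_mul_inv, fwdDiff_iter_comp_natCast_mul _ (R : ℝ)⁻¹, zero_add,
          Real.norm_eq_abs]
        gcongr
        exact hchoose hk
    _ ≤ (4 * d * (R : ℝ)⁻¹) ^ d * ((d + 1) * R) ^ d := by
        rw [← sum_mul]
        gcongr
        exact sum_abs_fwdDiff_cutoff_le d d _ (by positivity) le_rfl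
    _ = (4 * d * (d + 1)) ^ d := by
        rw [← mul_pow]
        congr 1
        field_simp

/-! ### Zonal polynomials -/

/-- The polynomials `1, 2 T₁, 2 T₂, …`, which are the zonal polynomials of the circle. -/
def circlePoly (R : Type*) [CommRing R] (m : ℕ) : R[X] :=
  if m = 0 then 1 else 2 * Chebyshev.T R m

/-- The zonal polynomial of degree `k` of the sphere in real dimension `2 * l + 2`, normalized to
be the profile of a reproducing kernel. -/
def zonalPoly (l k : ℕ) : ℝ[X] :=
  C (((2 ^ l * l.factorial : ℕ) : ℝ)⁻¹) * derivative^[l] (circlePoly ℝ (k + l))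

/-- The formal power series `1 - 2 a r + r²` in `r`. The Poisson kernel of the sphere in real
dimension `2 * l + 2` is `(1 - r²) / (1 - 2 a r + r²) ^ (l + 1)`, with `a` the real part of the
inner product. -/
def poissonDenom {R : Type*} [CommRing R] (a : R) : R⟦X⟧ :=
  1 - PowerSeries.C (2 * a) * PowerSeries.X + PowerSeries.X ^ 2

section PoissonDenom

variable {R : Type*} [CommRing R]

theorem coeff_poissonDenom_mul (a : R) (f : R⟦X⟧) (m : ℕ) :
    PowerSeries.coeff (m + 2) (poissonDenom a * f) =
      PowerSeries.coeff (m + 2) f - 2 * a * PowerSeries.coeff (m + 1) f +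
        PowerSeries.coeff m f := by
  rw [poissonDenom, add_mul, sub_mul, one_mul, mul_assoc, map_add, map_sub, PowerSeries.coeff_C_mul,
    PowerSeries.coeff_succ_X_mul, PowerSeries.coeff_X_pow_mul]

@[simp]
theorem constantCoeff_poissonDenom (a : R) : PowerSeries.constantCoeff (poissonDenom a) = 1 := by
  simp [poissonDenom]

@[simp]
theorem coeff_one_poissonDenom (a : R) : PowerSeries.coeff 1 (poissonDenom a) = -(2 * a) := by
  simp [poissonDenom, PowerSeries.coeff_one, PowerSeries.coeff_X_pow]

theorem map_poissonDenom {S : Type*} [CommRing S] (φ : R →+* S) (a : R) :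
    PowerSeries.map φ (poissonDenom a) = poissonDenom (φ a) := by
  simp [poissonDenom, map_ofNat φ]

theorem poissonDenom_X_mul_mk_circlePoly :
    poissonDenom (X : R[X]) * PowerSeries.mk (circlePoly R) = 1 - PowerSeries.X ^ 2 := by
  ext1 m
  match m with
  | 0 => simp [circlePoly]
  | 1 =>
    simp [PowerSeries.coeff_one_mul, circlePoly, PowerSeries.coeff_one, PowerSeries.coeff_X_pow]
  | 2 =>
    rw [coeff_poissonDenom_mul X _ 0]
    simp only [zero_add, PowerSeries.coeff_mk, circlePoly, OfNat.ofNat_ne_zero, ↓reduceIte,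
      Nat.cast_ofNat, Chebyshev.T_two, one_ne_zero, Nat.cast_one, Chebyshev.T_one, map_sub,
      PowerSeries.coeff_one, PowerSeries.coeff_X_pow]
    ring
  | m + 3 =>
    rw [coeff_poissonDenom_mul]
    simp only [PowerSeries.coeff_mk, circlePoly, Nat.add_eq_zero_iff, one_ne_zero, and_false,
      OfNat.ofNat_ne_zero, and_self, ↓reduceIte, Nat.cast_add, Nat.cast_one, Nat.cast_ofNat,
      Chebyshev.T_add_two, map_sub, PowerSeries.coeff_one, PowerSeries.coeff_X_pow,
      Nat.reduceEqDiff]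
    ring

end PoissonDenom

/-- The derivation of `A⟦X⟧` that applies the derivation `D` of `A` to every coefficient. -/
def coeffDerivation {R A : Type*} [CommRing R] [CommRing A] [Algebra R A] (D : Derivation R A A) :
    Derivation R A⟦X⟧ A⟦X⟧ :=
  Derivation.mk'
    { toFun := fun f => PowerSeries.mk fun m => D (PowerSeries.coeff m f)
      map_add' := fun f g => by ext1 m; simp
      map_smul' := fun c f => by ext1 m; simp }
    (fun f g => by
      ext1 m
      simp only [LinearMap.coe_mk, AddHom.coe_mk, PowerSeries.coeff_mk, PowerSeries.coeff_mul,
        map_sum, smul_eq_mul, map_add, D.leibniz, sum_add_distrib]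
      congr 1
      exact Nat.sum_antidiagonal_swap.symm)

section CoeffDerivation

variable {R A : Type*} [CommRing R] [CommRing A] [Algebra R A] (D : Derivation R A A)

theorem coeff_coeffDerivation (f : A⟦X⟧) (m : ℕ) :
    PowerSeries.coeff m (coeffDerivation D f) = D (PowerSeries.coeff m f) := by
  simp [coeffDerivation]

theorem coeffDerivation_C (a : A) :
    coeffDerivation D (PowerSeries.C a) = PowerSeries.C (D a) := by
  ext1 m
  rw [coeff_coeffDerivation, PowerSeries.coeff_C, PowerSeries.coeff_C]
  split_ifs <;> simp

theorem coeffDerivation_X : coeffDerivation D PowerSeries.X = 0 := by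
  ext1 m
  rw [coeff_coeffDerivation, PowerSeries.coeff_X]
  split_ifs <;> simp

theorem coeffDerivation_poissonDenom (a : A) :
    coeffDerivation D (poissonDenom a) = -(PowerSeries.C (2 * D a) * PowerSeries.X) := by
  have hD : D (2 * a) = 2 * D a := by rw [two_mul, two_mul, map_add]
  rw [poissonDenom, map_add, map_sub, Derivation.map_one_eq_zero, Derivation.leibniz,
    Derivation.leibniz_pow, coeffDerivation_C, coeffDerivation_X, hD]
  simp only [smul_eq_mul]
  ring

end CoeffDerivation

theorem poissonDenom_X_pow_mul_mk_iterate_derivative (R : Type*) [CommRing R] (l : ℕ) :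
    poissonDenom (X : R[X]) ^ (l + 1) *
        PowerSeries.mk (fun m => derivative^[l] (circlePoly R m)) =
      ((2 ^ l * l.factorial : ℕ) : R[X]⟦X⟧) * PowerSeries.X ^ l * (1 - PowerSeries.X ^ 2) := by
  induction l with
  | zero => simpa using poissonDenom_X_mul_mk_circlePoly
  | succ l ih =>
    set D := coeffDerivation (derivative' (R := R))
    set P := poissonDenom (X : R[X])
    have hder : D (PowerSeries.mk fun m => derivative^[l] (circlePoly R m)) =
        PowerSeries.mk fun m => derivative^[l + 1] (circlePoly R m) := by
      ext1 m
      rw [coeff_coeffDerivation, PowerSeries.coeff_mk, PowerSeries.coeff_mk,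
        Function.iterate_succ_apply']
      rfl
    have hP : D P = -(2 * PowerSeries.X) := by
      simp [D, P, coeffDerivation_poissonDenom, map_ofNat PowerSeries.C]
    have hX : D PowerSeries.X = 0 := coeffDerivation_X _
    have h := congrArg D ih
    simp only [Derivation.leibniz, Derivation.leibniz_pow, hder, hP, hX, map_sub,
      Derivation.map_natCast, Derivation.map_one_eq_zero, smul_eq_mul, nsmul_eq_mul, mul_zero,
      add_zero, sub_zero, Nat.add_sub_cancel] at h
    rw [Nat.factorial_succ]
    push_cast at h ih ⊢
    linear_combination P * h + 2 * PowerSeries.X * (l + 1) * ih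

theorem natDegree_circlePoly_le (R : Type*) [CommRing R] (m : ℕ) :
    (circlePoly R m).natDegree ≤ m := by
  unfold circlePoly
  split_ifs
  · simp
  · rw [← Chebyshev.map_T (Int.castRingHom R), ← map_ofNat C 2]
    exact (natDegree_C_mul_le _ _).trans (natDegree_map_le.trans (by simp))

theorem mk_iterate_derivative_circlePoly (l : ℕ) :
    PowerSeries.mk (fun m => derivative^[l] (circlePoly ℝ m)) =
      ((2 ^ l * l.factorial : ℕ) : ℝ[X]⟦X⟧) * PowerSeries.X ^ l * PowerSeries.mk (zonalPoly l) := by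
  ext1 m
  have hC : ((2 ^ l * l.factorial : ℕ) : ℝ[X]⟦X⟧) =
      PowerSeries.C (C ((2 ^ l * l.factorial : ℕ) : ℝ)) := by
    simp only [map_natCast]
  rw [hC, mul_assoc, PowerSeries.coeff_C_mul, PowerSeries.coeff_X_pow_mul', PowerSeries.coeff_mk]
  split_ifs with h
  · rw [PowerSeries.coeff_mk, zonalPoly, Nat.sub_add_cancel h, ← mul_assoc, ← C_mul,
      mul_inv_cancel₀ (by positivity), C_1, one_mul]
  · rw [mul_zero]
    exact iterate_derivative_eq_zero ((natDegree_circlePoly_le ℝ m).trans_lt (not_le.1 h))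

theorem poissonDenom_X_pow_mul_mk_zonalPoly (l : ℕ) :
    poissonDenom (X : ℝ[X]) ^ (l + 1) * PowerSeries.mk (zonalPoly l) = 1 - PowerSeries.X ^ 2 := by
  have hne : ((2 ^ l * l.factorial : ℕ) : ℝ[X]⟦X⟧) * PowerSeries.X ^ l ≠ 0 :=
    mul_ne_zero (by rw [← map_natCast PowerSeries.C, Ne,
      map_eq_zero_iff _ PowerSeries.C_injective, Nat.cast_eq_zero]; positivity)
      (pow_ne_zero _ PowerSeries.X_ne_zero)
  refine mul_left_cancel₀ hne ?_
  rw [← poissonDenom_X_pow_mul_mk_iterate_derivative, mk_iterate_derivative_circlePoly]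
  ring

/-- The generating series of the values of the zonal polynomials at `t`. -/
def zonalSeries (l : ℕ) (t : ℝ) : ℝ⟦X⟧ :=
  PowerSeries.mk fun k => (zonalPoly l k).eval t

theorem poissonDenom_pow_mul_zonalSeries (l : ℕ) (t : ℝ) :
    poissonDenom t ^ (l + 1) * zonalSeries l t = 1 - PowerSeries.X ^ 2 := by
  have hmap : PowerSeries.map (evalRingHom t) (PowerSeries.mk (zonalPoly l)) = zonalSeries l t := by
    ext1 m
    simp [zonalSeries]
  have h := congrArg (PowerSeries.map (evalRingHom t)) (poissonDenom_X_pow_mul_mk_zonalPoly l)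
  simpa [map_poissonDenom, hmap] using h

@[simp]
theorem zonalPoly_zero (l : ℕ) : zonalPoly l 0 = 1 := by
  simpa using congrArg PowerSeries.constantCoeff (poissonDenom_X_pow_mul_mk_zonalPoly l)

theorem zonalPoly_one (l : ℕ) : zonalPoly l 1 = C (2 * (l + 1 : ℝ)) * X := by
  have h := congrArg (PowerSeries.coeff 1) (poissonDenom_X_pow_mul_mk_zonalPoly l)
  simp only [PowerSeries.coeff_one_mul, PowerSeries.coeff_one_pow, Nat.cast_add, Nat.cast_one,
    coeff_one_poissonDenom, constantCoeff_poissonDenom, one_pow, mul_one, map_pow, map_sub,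
    PowerSeries.constantCoeff_mk, zonalPoly_zero, PowerSeries.coeff_mk, PowerSeries.coeff_one,
    one_ne_zero, ↓reduceIte, PowerSeries.coeff_X_pow, OfNat.one_ne_ofNat, sub_self] at h
  simp only [map_mul, map_add, map_natCast, map_one, map_ofNat]
  linear_combination h

theorem zonalPoly_ode (l k : ℕ) :
    (1 - X ^ 2) * derivative (derivative (zonalPoly l k)) -
      C (2 * l + 1 : ℝ) * X * derivative (zonalPoly l k) +
      C (k * (k + 2 * l) : ℝ) * zonalPoly l k = 0 := by
  rcases Nat.eq_zero_or_pos (k + l) with h0 | h0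
  · obtain ⟨rfl, rfl⟩ : k = 0 ∧ l = 0 := by lia
    simp
  · have hz : zonalPoly l k = C (((2 ^ l * l.factorial : ℕ) : ℝ)⁻¹ * 2) *
        derivative^[l] (Chebyshev.T ℝ ((k + l : ℕ) : ℤ)) := by
      rw [zonalPoly, circlePoly, if_neg h0.ne', ← map_ofNat C 2, iterate_derivative_C_mul, C_mul,
        mul_assoc]
    generalize ((2 ^ l * l.factorial : ℕ) : ℝ)⁻¹ = c at hz
    have h := Chebyshev.one_sub_X_sq_mul_iterate_derivative_T_eq_poly_in_T (R := ℝ)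
      ((k + l : ℕ) : ℤ) l
    simp only [Function.iterate_succ_apply', Int.cast_natCast] at h
    simp only [hz, derivative_C_mul]
    simp only [C_mul, C_add, map_natCast, C_1, map_ofNat]
    push_cast at h ⊢
    linear_combination C c * 2 * h

/-! ### Positivity of the Cesàro kernels -/

theorem coeff_succ_one_sub_X_mul {R : Type*} [Ring R] (f : R⟦X⟧) (m : ℕ) :
    PowerSeries.coeff (m + 1) ((1 - PowerSeries.X) * f) =
      PowerSeries.coeff (m + 1) f - PowerSeries.coeff m f := by
  rw [sub_mul, one_mul, map_sub, PowerSeries.coeff_succ_X_mul]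

theorem poissonDenom_mul_one_sub_X_mul_mk_sq_eval_U {R : Type*} [CommRing R] (c : R) :
    poissonDenom (2 * c ^ 2 - 1) * ((1 - PowerSeries.X) *
      PowerSeries.mk fun m : ℕ => (Chebyshev.U R m).eval c ^ 2) = 1 + PowerSeries.X := by
  obtain ⟨u, hu⟩ : ∃ u : ℕ → R, ∀ m : ℕ, (Chebyshev.U R m).eval c = u m := ⟨_, fun _ => rfl⟩
  have hu0 : u 0 = 1 := by simp [← hu]
  have hu1 : u 1 = 2 * c := by simp [← hu]
  have hrec (m : ℕ) : u (m + 2) = 2 * c * u (m + 1) - u m := by simp [← hu, Chebyshev.U_add_two]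
  simp only [hu]
  ext1 m
  match m with
  | 0 => simp [hu0]
  | 1 =>
    simp only [PowerSeries.coeff_one_mul, coeff_one_poissonDenom, constantCoeff_poissonDenom,
      coeff_succ_one_sub_X_mul _ 0, PowerSeries.coeff_mk, map_mul, map_add, map_sub, map_one,
      PowerSeries.constantCoeff_X, PowerSeries.constantCoeff_mk, PowerSeries.coeff_one,
      PowerSeries.coeff_one_X, hu0, hu1, one_ne_zero, ↓reduceIte, zero_add]
    ring
  | 2 =>
    rw [coeff_poissonDenom_mul _ _ 0]
    simp only [coeff_succ_one_sub_X_mul, PowerSeries.coeff_mk, hrec 0, zero_add, hu1, hu0, one_pow,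
      PowerSeries.coeff_zero_eq_constantCoeff, map_mul, map_sub, map_one,
      PowerSeries.constantCoeff_X, PowerSeries.constantCoeff_mk, map_add, PowerSeries.coeff_one,
      OfNat.ofNat_ne_zero, ↓reduceIte, PowerSeries.coeff_X, OfNat.ofNat_ne_one]
    ring
  | m + 3 =>
    rw [coeff_poissonDenom_mul _ _ (m + 1)]
    simp only [coeff_succ_one_sub_X_mul, PowerSeries.coeff_mk, map_add, PowerSeries.coeff_one,
      PowerSeries.coeff_X, hrec (m + 1), hrec m, Nat.add_eq_zero_iff, OfNat.ofNat_ne_zero,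
      and_false, ↓reduceIte, Nat.reduceEqDiff]
    ring

theorem one_sub_X_sq_mul_mk_even (R : Type*) [CommRing R] :
    (1 - PowerSeries.X ^ 2) * PowerSeries.mk (fun m => if Even m then (1 : R) else 0) = 1 := by
  ext1 m
  rw [sub_mul, one_mul, map_sub, PowerSeries.coeff_X_pow_mul', PowerSeries.coeff_one]
  match m with
  | 0 => simp
  | 1 => simp
  | m + 2 => simp [Nat.even_add]

theorem coeff_mul_nonneg {R : Type*} [CommRing R] [PartialOrder R] [IsOrderedRing R] {f g : R⟦X⟧}
    (hf : ∀ m, 0 ≤ PowerSeries.coeff m f) (hg : ∀ m, 0 ≤ PowerSeries.coeff m g) (m : ℕ) :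
    0 ≤ PowerSeries.coeff m (f * g) := by
  rw [PowerSeries.coeff_mul]
  exact sum_nonneg fun p _ => mul_nonneg (hf _) (hg _)

theorem coeff_pow_nonneg {R : Type*} [CommRing R] [PartialOrder R] [IsOrderedRing R] {f : R⟦X⟧}
    (hf : ∀ m, 0 ≤ PowerSeries.coeff m f) (l m : ℕ) : 0 ≤ PowerSeries.coeff m (f ^ l) := by
  induction l generalizing m with
  | zero =>
    rw [pow_zero, PowerSeries.coeff_one]
    split_ifs <;> simp
  | succ l ih =>
    rw [pow_succ]
    exact coeff_mul_nonneg ih hf m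

theorem invOneSubPow_mul_one_sub_X_pow (R : Type*) [CommRing R] (s : ℕ) :
    (PowerSeries.invOneSubPow R s).val * (1 - PowerSeries.X) ^ s = 1 := by
  rw [← PowerSeries.invOneSubPow_inv_eq_one_sub_pow]
  exact (PowerSeries.invOneSubPow R s).val_inv

/-- The Cesàro kernel of order `2 * l + 1`, not normalized, as a function of the real part of the
inner product. -/
def cesaroKernel (l m : ℕ) (t : ℝ) : ℝ :=
  PowerSeries.coeff m ((PowerSeries.invOneSubPow ℝ (2 * l + 2)).val * zonalSeries l t)

theorem cesaroKernel_eq_sum (l m : ℕ) (t : ℝ) :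
    cesaroKernel l m t = ∑ j ∈ range (m + 1),
      ((2 * l + 1 + (m - j)).choose (2 * l + 1) : ℝ) * (zonalPoly l j).eval t := by
  rw [cesaroKernel, mul_comm, PowerSeries.coeff_mul, Nat.sum_antidiagonal_eq_sum_range_succ
    (fun i j => PowerSeries.coeff i (zonalSeries l t) *
      PowerSeries.coeff j (PowerSeries.invOneSubPow ℝ (2 * l + 2)).val)]
  refine sum_congr rfl fun j _ => ?_
  rw [PowerSeries.invOneSubPow_val_succ_eq_mk_add_choose, PowerSeries.coeff_mk, zonalSeries,
    PowerSeries.coeff_mk, mul_comm]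

theorem invOneSubPow_mul_zonalSeries (l : ℕ) (c : ℝ) :
    (PowerSeries.invOneSubPow ℝ (2 * l + 2)).val * zonalSeries l (2 * c ^ 2 - 1) =
      PowerSeries.mk (fun m : ℕ => (Chebyshev.U ℝ m).eval c ^ 2) ^ (l + 1) *
        PowerSeries.mk (fun m => if Even m then 1 else 0) ^ l := by
  set t : ℝ := 2 * c ^ 2 - 1
  have hA := poissonDenom_mul_one_sub_X_mul_mk_sq_eval_U c
  have hB := one_sub_X_sq_mul_mk_even ℝ
  have hI := invOneSubPow_mul_one_sub_X_pow ℝ (2 * l + 2)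
  have hZ := poissonDenom_pow_mul_zonalSeries l t
  set A : ℝ⟦X⟧ := PowerSeries.mk fun m : ℕ => (Chebyshev.U ℝ m).eval c ^ 2
  set B : ℝ⟦X⟧ := PowerSeries.mk fun m => if Even m then 1 else 0
  set I := (PowerSeries.invOneSubPow ℝ (2 * l + 2)).val
  set P := poissonDenom t
  have hP : P ≠ 0 := fun h => by simpa [P] using congrArg PowerSeries.constantCoeff h
  have hX : (1 - PowerSeries.X : ℝ⟦X⟧) ≠ 0 := fun h => by
    simpa using congrArg PowerSeries.constantCoeff h
  refine mul_left_cancel₀ (mul_ne_zero (pow_ne_zero (2 * l + 2) hX) (pow_ne_zero (l + 1) hP)) ?_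
  generalize (PowerSeries.X : ℝ⟦X⟧) = x at *
  calc (1 - x) ^ (2 * l + 2) * P ^ (l + 1) * (I * zonalSeries l t)
      = (I * (1 - x) ^ (2 * l + 2)) * (P ^ (l + 1) * zonalSeries l t) := by ring
    _ = (1 - x ^ 2) * ((1 - x ^ 2) * B) ^ l := by rw [hI, hZ, hB, one_mul, one_pow, mul_one]
    _ = (1 - x) ^ (l + 1) * (1 + x) ^ (l + 1) * B ^ l := by
        rw [← mul_pow, show (1 - x) * (1 + x) = 1 - x ^ 2 by ring, mul_pow]
        ring
    _ = (1 - x) ^ (2 * l + 2) * P ^ (l + 1) * (A ^ (l + 1) * B ^ l) := by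
        rw [← hA]
        generalize 1 - x = y
        ring

theorem cesaroKernel_nonneg (l m : ℕ) {t : ℝ} (ht : -1 ≤ t) : 0 ≤ cesaroKernel l m t := by
  have hc : t = 2 * √((1 + t) / 2) ^ 2 - 1 := by
    rw [Real.sq_sqrt (by linarith)]
    ring
  rw [cesaroKernel, hc, invOneSubPow_mul_zonalSeries]
  refine coeff_mul_nonneg (coeff_pow_nonneg (fun i => ?_) _) (coeff_pow_nonneg (fun i => ?_) _) m
  · rw [PowerSeries.coeff_mk]
    positivity
  · rw [PowerSeries.coeff_mk]
    split_ifs <;> simp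

/-! ### Iterated summation by parts -/

theorem sum_range_mul_eq_sum_sub_mul {R : Type*} [CommRing R] (g a : ℕ → R) (K : ℕ) :
    ∑ k ∈ range K, g k * a k =
      ∑ k ∈ range K, (g k - g (k + 1)) * ∑ i ∈ range (k + 1), a i +
        g K * ∑ i ∈ range K, a i := by
  induction K with
  | zero => simp
  | succ K ih =>
    rw [sum_range_succ, ih, sum_range_succ _ K, sum_range_succ a K]
    ring

theorem coeff_invOneSubPow_succ_mul {R : Type*} [CommRing R] (s k : ℕ) (f : R⟦X⟧) :
    PowerSeries.coeff k ((PowerSeries.invOneSubPow R (s + 1)).val * f) =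
      ∑ i ∈ range (k + 1), PowerSeries.coeff i ((PowerSeries.invOneSubPow R s).val * f) := by
  rw [PowerSeries.invOneSubPow_add, Units.val_mul, mul_right_comm, PowerSeries.coeff_mul,
    Nat.sum_antidiagonal_eq_sum_range_succ
      (fun i j => PowerSeries.coeff i ((PowerSeries.invOneSubPow R s).val * f) *
        PowerSeries.coeff j (PowerSeries.invOneSubPow R 1).val)]
  simp [PowerSeries.invOneSubPow_val_succ_eq_mk_add_choose R 0]

theorem sum_mul_coeff_eq_sum_fwdDiff {R : Type*} [CommRing R] {g : ℕ → R} {K : ℕ}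
    (hg : ∀ k, K ≤ k → g k = 0) (f : R⟦X⟧) (s : ℕ) :
    ∑ k ∈ range K, g k * PowerSeries.coeff k f =
      ∑ k ∈ range K, (-1) ^ s * (fwdDiff 1)^[s] g k *
        PowerSeries.coeff k ((PowerSeries.invOneSubPow R s).val * f) := by
  have hzero (s : ℕ) : (fwdDiff 1)^[s] g K = 0 := by
    rw [fwdDiff_iter_eq_sum_shift]
    exact sum_eq_zero fun j _ => by rw [hg _ (Nat.le_add_right _ _), smul_zero]
  induction s with
  | zero => simp [PowerSeries.invOneSubPow_zero]
  | succ s ih =>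
    rw [ih, sum_range_mul_eq_sum_sub_mul, hzero, mul_zero, zero_mul, add_zero]
    refine sum_congr rfl fun k _ => ?_
    rw [coeff_invOneSubPow_succ_mul, Function.iterate_succ_apply', fwdDiff]
    ring

theorem abs_sum_mul_zonalPoly_le (l : ℕ) {g : ℕ → ℝ} {K : ℕ} (hg : ∀ k, K ≤ k → g k = 0) {t : ℝ}
    (ht : -1 ≤ t) : |∑ k ∈ range K, g k * (zonalPoly l k).eval t| ≤
      ∑ k ∈ range K, |(fwdDiff 1)^[2 * l + 2] g k| * cesaroKernel l k t := by
  have hsum := sum_mul_coeff_eq_sum_fwdDiff hg (zonalSeries l t) (2 * l + 2)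
  simp only [zonalSeries, PowerSeries.coeff_mk] at hsum
  rw [hsum]
  refine (abs_sum_le_sum_abs _ _).trans_eq (sum_congr rfl fun k _ => ?_)
  rw [abs_mul, abs_mul, abs_neg_one_pow, one_mul]
  exact congrArg _ (abs_of_nonneg (cesaroKernel_nonneg l k ht))

/-! ### The Green identity for functions constant on rays -/

section Green

variable {E : Type*} [NormedAddCommGroup E]

theorem hasCompactSupport_comp_norm_sq [ProperSpace E] {M : Type*} [Zero M] {η : ℝ → M}
    (hη : HasCompactSupport η) : HasCompactSupport fun x : E => η (‖x‖ ^ 2) := by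
  simp only [hasCompactSupport_iff_eventuallyEq, Filter.coclosedCompact_eq_cocompact] at hη ⊢
  have hη' : ∀ᶠ s in Filter.atTop, η s = 0 := hη.filter_mono atTop_le_cocompact
  exact ((Filter.tendsto_pow_atTop two_ne_zero).comp tendsto_norm_cocompact_atTop).eventually hη'

section NormedSpace

variable [NormedSpace ℝ E] {F : Type*} [NormedAddCommGroup F] [NormedSpace ℝ F] {f : E → F} {x : E}

theorem iteratedFDeriv_two_eq_fderiv (hf : ContDiffAt ℝ 2 f x) (v : E) :
    iteratedFDeriv ℝ 2 f x ![v, v] = fderiv ℝ (fun y => fderiv ℝ f y v) x v := by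
  have h : DifferentiableAt ℝ (fderiv ℝ f) x :=
    (hf.fderiv_right (m := 1) (by norm_num)).differentiableAt (by norm_num)
  rw [iteratedFDeriv_two_apply, fderiv_clm_apply h (by fun_prop)]
  simp

theorem contDiffAt_fderiv_apply (hf : ContDiffAt ℝ 2 f x) (v : E) :
    ContDiffAt ℝ 1 (fun y => fderiv ℝ f y v) x :=
  (hf.fderiv_right (m := 1) (by norm_num)).clm_apply contDiffAt_const

/-- Functions that are constant on the open rays from the origin. -/
def IsConstOnRays {Y : Type*} (f : E → Y) : Prop :=
  ∀ c : ℝ, 0 < c → ∀ x, f (c • x) = f x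

theorem IsConstOnRays.fderiv_apply_self (hf : IsConstOnRays f) (hx : DifferentiableAt ℝ f x) :
    fderiv ℝ f x x = 0 := by
  have hray : HasDerivAt (fun c : ℝ => f (c • x)) (fderiv ℝ f x x) 1 := by
    have hline : HasDerivAt (fun c : ℝ => c • x) x 1 := by
      simpa using (hasDerivAt_id (1 : ℝ)).smul_const x
    refine HasFDerivAt.comp_hasDerivAt (l := f) 1 ?_ hline
    simpa using hx.hasFDerivAt
  have hconst : HasDerivAt (fun c : ℝ => f (c • x)) 0 1 := by
    refine (hasDerivAt_const (1 : ℝ) (f x)).congr_of_eventuallyEq ?_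
    filter_upwards [lt_mem_nhds (zero_lt_one (α := ℝ))] with c hc
    exact hf c hc x
  exact hray.unique hconst

variable [MeasurableSpace E] [BorelSpace E] (μ : Measure E)

theorem integrable_fderiv_apply [IsFiniteMeasureOnCompacts μ] (hf : ContDiff ℝ 1 f)
    (hs : HasCompactSupport f) (v : E) : Integrable (fun x => fderiv ℝ f x v) μ :=
  ((hf.continuous_fderiv (by norm_num)).clm_apply continuous_const).integrable_of_hasCompactSupport
    (hs.fderiv_apply (𝕜 := ℝ) v)

theorem integral_fderiv_eq_zero [FiniteDimensional ℝ E] [μ.IsAddHaarMeasure] {H : E → ℂ}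
    (hH : ContDiff ℝ 1 H) (hs : HasCompactSupport H) (v : E) : ∫ x, fderiv ℝ H x v ∂μ = 0 := by
  simpa using integral_mul_fderiv_eq_neg_fderiv_mul_of_integrable (μ := μ) (f := fun _ => (1 : ℂ))
    (g := H) (v := v) (by simp) (by simpa using integrable_fderiv_apply μ hH hs v)
    (by simpa using hH.continuous.integrable_of_hasCompactSupport hs)
    (fun x _ => by fun_prop) (fun x _ => (hH.differentiable (by norm_num)).differentiableAt)

end NormedSpace

variable [InnerProductSpace ℝ E]

theorem fderiv_comp_norm_sq_apply {η : ℝ → ℝ} (hη : Differentiable ℝ η) (x v : E) :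
    fderiv ℝ (fun y : E => (η (‖y‖ ^ 2) : ℂ)) x v =
      ((2 * deriv η (‖x‖ ^ 2) : ℝ) : ℂ) * (inner ℝ x v : ℝ) := by
  have h : HasFDerivAt (fun y : E => (η (‖y‖ ^ 2) : ℂ)) _ x :=
    Complex.ofRealCLM.hasFDerivAt.comp x
      ((hη (‖x‖ ^ 2)).hasDerivAt.comp_hasFDerivAt x (hasStrictFDerivAt_norm_sq x).hasFDerivAt)
  rw [h.fderiv]
  simp
  ring

/-- The vector field `φ (G ∇F - F ∇G)`, whose divergence is the integrand of the Green identity,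
given by its component in the direction `v`. -/
def greenField (φ F G : E → ℂ) (v x : E) : ℂ :=
  φ x * (G x * fderiv ℝ F x v - F x * fderiv ℝ G x v)

section greenField

variable {φ F G : E → ℂ}

theorem greenField_eventuallyEq_zero {x : E} (hφ : φ =ᶠ[nhds x] 0) (v : E) :
    greenField φ F G v =ᶠ[nhds x] 0 := by
  filter_upwards [hφ] with y hy
  simp [greenField, hy]

theorem contDiff_greenField (hφ : ContDiff ℝ 1 φ) (hφ0 : φ =ᶠ[nhds 0] 0)
    (hF : ∀ x ≠ 0, ContDiffAt ℝ 2 F x) (hG : ∀ x ≠ 0, ContDiffAt ℝ 2 G x) (v : E) :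
    ContDiff ℝ 1 (greenField φ F G v) := by
  refine contDiff_iff_contDiffAt.2 fun x => ?_
  obtain rfl | hx := eq_or_ne x 0
  · exact contDiffAt_const.congr_of_eventuallyEq (greenField_eventuallyEq_zero hφ0 v)
  · have hF1 : ContDiffAt ℝ 1 F x := (hF x hx).of_le (by norm_num)
    have hG1 : ContDiffAt ℝ 1 G x := (hG x hx).of_le (by norm_num)
    exact hφ.contDiffAt.mul ((hG1.mul (contDiffAt_fderiv_apply (hF x hx) v)).sub
      (hF1.mul (contDiffAt_fderiv_apply (hG x hx) v)))

theorem hasCompactSupport_greenField (hφ : HasCompactSupport φ) (v : E) :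
    HasCompactSupport (greenField φ F G v) :=
  hφ.mul_right

theorem fderiv_greenField_apply {x : E} (hφ : DifferentiableAt ℝ φ x) (hF : ContDiffAt ℝ 2 F x)
    (hG : ContDiffAt ℝ 2 G x) (v : E) :
    fderiv ℝ (greenField φ F G v) x v =
      G x * (fderiv ℝ φ x v * fderiv ℝ F x v) - F x * (fderiv ℝ φ x v * fderiv ℝ G x v) +
        φ x * (G x * fderiv ℝ (fun y => fderiv ℝ F y v) x v -
          F x * fderiv ℝ (fun y => fderiv ℝ G y v) x v) := by
  have hF1 := (hF.differentiableAt (by norm_num)).hasFDerivAt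
  have hG1 := (hG.differentiableAt (by norm_num)).hasFDerivAt
  have hF2 := ((contDiffAt_fderiv_apply hF v).differentiableAt (by norm_num)).hasFDerivAt
  have hG2 := ((contDiffAt_fderiv_apply hG v).differentiableAt (by norm_num)).hasFDerivAt
  have h : HasFDerivAt (greenField φ F G v) _ x :=
    hφ.hasFDerivAt.mul ((hG1.mul hF2).sub (hF1.mul hG2))
  rw [h.fderiv]
  simp
  ring

end greenField

theorem sum_fderiv_comp_norm_sq_mul_fderiv {ι : Type*} [Fintype ι] (b : OrthonormalBasis ι ℝ E)
    {η : ℝ → ℝ} (hη : Differentiable ℝ η) {f : E → ℂ} {x : E} (hf : fderiv ℝ f x x = 0) :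
    ∑ i, fderiv ℝ (fun y : E => (η (‖y‖ ^ 2) : ℂ)) x (b i) * fderiv ℝ f x (b i) = 0 := by
  have hcomp : ∀ i, fderiv ℝ (fun y : E => (η (‖y‖ ^ 2) : ℂ)) x (b i) * fderiv ℝ f x (b i) =
      ((2 * deriv η (‖x‖ ^ 2) : ℝ) : ℂ) * fderiv ℝ f x (inner ℝ (b i) x • b i) := fun i => by
    rw [fderiv_comp_norm_sq_apply hη, map_smul, real_inner_comm, Complex.real_smul, mul_assoc]
  rw [sum_congr rfl fun i _ => hcomp i, ← mul_sum, ← map_sum, b.sum_repr' x, hf, mul_zero]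

variable [FiniteDimensional ℝ E]

theorem laplacian_eq_sum_fderiv {F : Type*} [NormedAddCommGroup F] [NormedSpace ℝ F]
    {f : E → F} {x : E} (hf : ContDiffAt ℝ 2 f x) {ι : Type*} [Fintype ι]
    (b : OrthonormalBasis ι ℝ E) :
    Δ f x = ∑ i, fderiv ℝ (fun y => fderiv ℝ f y (b i)) x (b i) := by
  rw [InnerProductSpace.laplacian_eq_iteratedFDeriv_orthonormalBasis f b]
  exact sum_congr rfl fun i _ => iteratedFDeriv_two_eq_fderiv hf (b i)

theorem IsConstOnRays.laplacian_eq_smul {F : Type*} [NormedAddCommGroup F] [NormedSpace ℝ F]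
    {f : E → F} (hf : IsConstOnRays f) {c : ℝ} (hc : 0 < c) (x : E) :
    Δ f x = c ^ 2 • Δ f (c • x) := by
  have hfc : f = fun y => f (c • y) := funext fun y => (hf c hc y).symm
  have hf' : fderiv ℝ f = c • fun y => fderiv ℝ f (c • y) := funext fun y => by
    conv_lhs => rw [hfc, fderiv_comp_smul]
    rfl
  have hf'' : fderiv ℝ (fderiv ℝ f) x = c ^ 2 • fderiv ℝ (fderiv ℝ f) (c • x) := by
    let _ := invertibleOfNonzero hc.ne'
    conv_lhs => rw [hf']
    rw [fderiv_const_smul_of_invertible (𝕜 := ℝ) (f := fun y => fderiv ℝ f (c • y)) c,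
      fderiv_comp_smul, smul_smul, ← sq]
  rw [InnerProductSpace.laplacian_eq_iteratedFDeriv_stdOrthonormalBasis]
  simp only [iteratedFDeriv_two_apply, hf'', smul_sum]
  rfl

theorem sum_fderiv_greenField {ι : Type*} [Fintype ι] (b : OrthonormalBasis ι ℝ E)
    {η : ℝ → ℝ} (hη : ContDiff ℝ 1 η) {F G : E → ℂ} (hF' : IsConstOnRays F)
    (hG' : IsConstOnRays G) {x : E} (hF : ContDiffAt ℝ 2 F x) (hG : ContDiffAt ℝ 2 G x) :
    ∑ i, fderiv ℝ (greenField (fun y => (η (‖y‖ ^ 2) : ℂ)) F G (b i)) x (b i) =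
      (η (‖x‖ ^ 2) : ℂ) * (G x * Δ F x - F x * Δ G x) := by
  have hηd : Differentiable ℝ η := hη.differentiable (by norm_num)
  have hφ : DifferentiableAt ℝ (fun y : E => (η (‖y‖ ^ 2) : ℂ)) x :=
    Complex.ofRealCLM.differentiableAt.comp x
      ((hηd _).comp x (contDiff_norm_sq ℝ (n := 1)).contDiffAt.differentiableAt_one)
  have hFx := sum_fderiv_comp_norm_sq_mul_fderiv b hηd
    (hF'.fderiv_apply_self (hF.differentiableAt (by norm_num)))
  have hGx := sum_fderiv_comp_norm_sq_mul_fderiv b hηd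
    (hG'.fderiv_apply_self (hG.differentiableAt (by norm_num)))
  simp only [fderiv_greenField_apply hφ hF hG, sum_add_distrib, sum_sub_distrib, ← mul_sum, hFx,
    hGx, laplacian_eq_sum_fderiv hF b, laplacian_eq_sum_fderiv hG b, mul_zero, sub_zero, zero_add]

theorem integral_comp_norm_sq_mul_laplacian_sub [MeasurableSpace E] [BorelSpace E]
    (μ : Measure E) [μ.IsAddHaarMeasure] {F G : E → ℂ}
    (hF : ∀ x ≠ 0, ContDiffAt ℝ 2 F x) (hG : ∀ x ≠ 0, ContDiffAt ℝ 2 G x)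
    (hF' : IsConstOnRays F) (hG' : IsConstOnRays G) {η : ℝ → ℝ} (hη : ContDiff ℝ 1 η)
    (hηs : HasCompactSupport η) (hη0 : η =ᶠ[nhds 0] 0) :
    ∫ x, (η (‖x‖ ^ 2) : ℂ) * (G x * Δ F x - F x * Δ G x) ∂μ = 0 := by
  set b := stdOrthonormalBasis ℝ E
  set φ : E → ℂ := fun x => (η (‖x‖ ^ 2) : ℂ)
  have hφ : ContDiff ℝ 1 φ := Complex.ofRealCLM.contDiff.comp (hη.comp (contDiff_norm_sq ℝ))
  have hφs : HasCompactSupport φ :=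
    (hasCompactSupport_comp_norm_sq hηs).comp_left Complex.ofReal_zero
  have hφ0 : φ =ᶠ[nhds 0] 0 := by
    have hsq : Filter.Tendsto (fun x : E => ‖x‖ ^ 2) (nhds 0) (nhds 0) := by
      simpa using (by fun_prop : Continuous fun x : E => ‖x‖ ^ 2).tendsto 0
    filter_upwards [hsq.eventually hη0] with x hx
    simp [φ, hx]
  have hdiv : ∀ x, (η (‖x‖ ^ 2) : ℂ) * (G x * Δ F x - F x * Δ G x) =
      ∑ i, fderiv ℝ (greenField φ F G (b i)) x (b i) := fun x => by
    obtain rfl | hx := eq_or_ne x 0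
    · have hη00 : η 0 = 0 := hη0.self_of_nhds
      simp [(greenField_eventuallyEq_zero hφ0 _).fderiv_eq, hη00]
    · exact (sum_fderiv_greenField b hη hF' hG' (hF x hx) (hG x hx)).symm
  have hC (i) := contDiff_greenField hφ hφ0 hF hG (b i)
  have hS (i) := hasCompactSupport_greenField (F := F) (G := G) hφs (b i)
  rw [integral_congr_ae (.of_forall hdiv),
    integral_finsetSum _ fun i _ => integrable_fderiv_apply μ (hC i) (hS i) _]
  exact sum_eq_zero fun i _ => integral_fderiv_eq_zero μ (hC i) (hS i) _

end Green

/-! ### Orthogonality of the eigenspaces -/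

section Sphere

variable {n : ℕ}

theorem norm_coe_csphere (x : CSphere n) : ‖(x : EuclideanSpace ℂ (Fin n))‖ = 1 :=
  mem_sphere_zero_iff_norm.1 x.2

theorem coe_csphere_ne_zero (x : CSphere n) : (x : EuclideanSpace ℂ (Fin n)) ≠ 0 :=
  norm_ne_zero_iff.1 (by simp)

theorem isConstOnRays_radialExt (f : CSphere n → ℂ) : IsConstOnRays (radialExt f) := by
  intro c hc x
  obtain rfl | hx := eq_or_ne x 0
  · simp
  · simp only [radialExt, dif_neg hx, dif_neg (smul_ne_zero hc.ne' hx)]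
    congr 2
    rw [norm_smul, Real.norm_of_nonneg hc.le, smul_smul]
    congr 1
    field_simp

theorem radialExt_coe (f : CSphere n → ℂ) (x : CSphere n) : radialExt f x = f x := by
  simp only [radialExt, dif_neg (coe_csphere_ne_zero x)]
  congr 2
  simp

theorem radialExt_mul (f g : CSphere n → ℂ) (x : EuclideanSpace ℂ (Fin n)) :
    radialExt (f * g) x = radialExt f x * radialExt g x := by
  by_cases h : x = 0 <;> simp [radialExt, h]

theorem IsSmooth.contDiffAt {f : CSphere n → ℂ} (hf : IsSmooth f)
    {x : EuclideanSpace ℂ (Fin n)} (hx : x ≠ 0) : ContDiffAt ℝ 2 (radialExt f) x :=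
  (ContDiffOn.contDiffAt hf (isOpen_compl_singleton.mem_nhds hx)).of_le
    (WithTop.coe_le_coe.2 le_top)

theorem IsSmooth.continuous {f : CSphere n → ℂ} (hf : IsSmooth f) : Continuous f := by
  have hcomp : f = radialExt f ∘ Subtype.val := funext fun x => (radialExt_coe f x).symm
  rw [hcomp, continuous_iff_continuousAt]
  intro x
  exact (hf.contDiffAt (coe_csphere_ne_zero x)).continuousAt.comp
    continuous_subtype_val.continuousAt

theorem laplacian_radialExt_of_mem_eigenspace {k : ℕ} {f : CSphere n → ℂ}
    (hf : f ∈ eigenspace n k) {x : EuclideanSpace ℂ (Fin n)} (hx : x ≠ 0) :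
    ((‖x‖ ^ 2 : ℝ) : ℂ) * Δ (radialExt f) x = -((theta n k : ℂ) * radialExt f x) := by
  have hpos : 0 < ‖x‖ := norm_pos_iff.2 hx
  let y : CSphere n := ⟨‖x‖⁻¹ • x, by
    rw [mem_sphere_zero_iff_norm, norm_smul, norm_inv, norm_norm, inv_mul_cancel₀ hpos.ne']⟩
  have hlap : -Δ (radialExt f) (‖x‖⁻¹ • x) = (theta n k : ℂ) * f y := hf.2 y
  have hext : radialExt f x = f y := by simp only [radialExt, dif_neg hx, y]
  have hcancel : ‖x‖ ^ 2 * ‖x‖⁻¹ ^ 2 = 1 := by field_simp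
  rw [(isConstOnRays_radialExt f).laplacian_eq_smul (inv_pos.2 hpos) x, hext, ← hlap,
    Complex.real_smul, ← mul_assoc, ← Complex.ofReal_mul, hcancel, Complex.ofReal_one, one_mul,
    neg_neg]

theorem nontrivial_euclideanSpace (hn : 1 ≤ n) : Nontrivial (EuclideanSpace ℂ (Fin n)) := by
  have : Nonempty (Fin n) := ⟨⟨0, hn⟩⟩
  infer_instance

theorem integral_radial_mul_radialExt (hn : 1 ≤ n) (w : ℝ → ℂ) (f : CSphere n → ℂ) :
    ∫ x : EuclideanSpace ℂ (Fin n), w ‖x‖ * radialExt f x =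
      (∫ x, f x ∂(volume : Measure (EuclideanSpace ℂ (Fin n))).toSphere) *
        ∫ r : Set.Ioi (0 : ℝ), w r
          ∂(Measure.volumeIoiPow (Module.finrank ℝ (EuclideanSpace ℂ (Fin n)) - 1)) := by
  have := nontrivial_euclideanSpace hn
  set μ : Measure (EuclideanSpace ℂ (Fin n)) := volume
  calc ∫ x, w ‖x‖ * radialExt f x ∂μ
      = ∫ x : ({(0)}ᶜ : Set (EuclideanSpace ℂ (Fin n))), w ‖x.1‖ * radialExt f x.1
          ∂(μ.comap (↑)) := by
        rw [integral_subtype_comap (measurableSet_singleton _).compl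
          fun x => w ‖x‖ * radialExt f x, restrict_compl_singleton]
    _ = ∫ z : CSphere n × Set.Ioi (0 : ℝ), f z.1 * w z.2
          ∂μ.toSphere.prod (.volumeIoiPow (Module.finrank ℝ (EuclideanSpace ℂ (Fin n)) - 1)) := by
        rw [← μ.measurePreserving_homeomorphUnitSphereProd.integral_comp
          (Homeomorph.measurableEmbedding _)]
        refine integral_congr_ae (.of_forall fun x => ?_)
        have hx : (x : EuclideanSpace ℂ (Fin n)) ≠ 0 := x.2
        simp only [homeomorphUnitSphereProd_apply_snd_coe, radialExt, dif_neg hx]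
        rw [mul_comm]
        congr 2
        ext1
        simp
    _ = _ := integral_prod_mul f fun r : Set.Ioi (0 : ℝ) => w r

theorem theta_injective (hn : 1 ≤ n) : Function.Injective (theta n) := by
  refine StrictMono.injective (strictMono_nat_of_lt_succ fun k => ?_)
  have hn' : (1 : ℝ) ≤ n := by exact_mod_cast hn
  rw [theta, theta, dim, Nat.cast_sub (by omega)]
  push_cast
  nlinarith [(Nat.cast_nonneg k : (0 : ℝ) ≤ k)]

theorem isProbabilityMeasure_nu (hn : 1 ≤ n) : IsProbabilityMeasure (nu n) := by
  have := nontrivial_euclideanSpace hn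
  have hσ : (volume : Measure (EuclideanSpace ℂ (Fin n))).toSphere Set.univ ≠ 0 :=
    Measure.measure_univ_eq_zero.not.2 (Measure.toSphere_ne_zero _)
  exact ⟨ENNReal.inv_mul_cancel hσ (measure_ne_top _ _)⟩

/-- A smooth bump supported in `[1, 3]`; composed with `‖x‖ ^ 2` it localizes the Green identity to
an annulus around the unit sphere. -/
def annularBump : ContDiffBump (2 : ℝ) := ⟨1 / 2, 1, by norm_num, by norm_num⟩

theorem annularBump_eq_zero {s : ℝ} (hs : s ≤ 1) : annularBump s = 0 := by
  refine annularBump.zero_of_le_dist ?_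
  rw [Real.dist_eq, abs_sub_comm]
  exact le_trans (by simp only [annularBump]; linarith) (le_abs_self _)

theorem integral_annularBump_norm_sq_pos {E : Type*} [NormedAddCommGroup E]
    [InnerProductSpace ℝ E] [FiniteDimensional ℝ E] [Nontrivial E] [MeasurableSpace E]
    [BorelSpace E] (μ : Measure E) [μ.IsAddHaarMeasure] :
    0 < ∫ x, annularBump (‖x‖ ^ 2) ∂μ := by
  obtain ⟨x, hx⟩ := exists_norm_eq E (Real.sqrt_nonneg 2)
  refine Continuous.integral_pos_of_hasCompactSupport_nonneg_nonzero
    (annularBump.continuous.comp (by fun_prop))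
    (hasCompactSupport_comp_norm_sq annularBump.hasCompactSupport)
    (fun _ => annularBump.nonneg) (x := x) ?_
  rw [hx, Real.sq_sqrt zero_le_two, annularBump.one_of_mem_closedBall (by simp [annularBump])]
  exact one_ne_zero

theorem integral_annularBump_volumeIoiPow_ne_zero (hn : 1 ≤ n) :
    ∫ r : Set.Ioi (0 : ℝ), (annularBump ((r : ℝ) ^ 2) : ℂ)
      ∂(Measure.volumeIoiPow (Module.finrank ℝ (EuclideanSpace ℂ (Fin n)) - 1)) ≠ 0 := by
  have := nontrivial_euclideanSpace hn
  have hext (x : EuclideanSpace ℂ (Fin n)) :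
      (annularBump (‖x‖ ^ 2) : ℂ) * radialExt (fun _ => 1) x = annularBump (‖x‖ ^ 2) := by
    obtain rfl | hx := eq_or_ne x 0
    · simp [annularBump_eq_zero]
    · simp [radialExt, hx]
  have hpolar := integral_radial_mul_radialExt hn (fun r => (annularBump (r ^ 2) : ℂ))
    fun _ : CSphere n => 1
  simp only [hext] at hpolar
  refine right_ne_zero_of_mul (hpolar.symm.trans_ne ?_)
  rw [integral_complex_ofReal]
  exact Complex.ofReal_ne_zero.2 (integral_annularBump_norm_sq_pos volume).ne'

theorem integral_mul_eq_zero_of_mem_eigenspace (hn : 1 ≤ n) {j k : ℕ} (hjk : j ≠ k)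
    {f g : CSphere n → ℂ} (hf : f ∈ eigenspace n j) (hg : g ∈ eigenspace n k) :
    ∫ x, f x * g x ∂(nu n) = 0 := by
  set η : ℝ → ℝ := fun s => s * annularBump s
  have hη0 : η =ᶠ[nhds 0] 0 := by
    filter_upwards [gt_mem_nhds (zero_lt_one (α := ℝ))] with s hs
    simp [η, annularBump_eq_zero hs.le]
  have hgreen := integral_comp_norm_sq_mul_laplacian_sub volume
    (fun x hx => hf.1.contDiffAt hx) (fun x hx => hg.1.contDiffAt hx) (isConstOnRays_radialExt f)
    (isConstOnRays_radialExt g) (contDiff_id.mul annularBump.contDiff)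
    annularBump.hasCompactSupport.mul_left hη0 (η := η)
  have hintegrand (x : EuclideanSpace ℂ (Fin n)) : (η (‖x‖ ^ 2) : ℂ) *
      (radialExt g x * Δ (radialExt f) x - radialExt f x * Δ (radialExt g) x) =
        ((theta n k : ℂ) - theta n j) *
          ((annularBump (‖x‖ ^ 2) : ℂ) * radialExt (f * g) x) := by
    obtain rfl | hx := eq_or_ne x 0
    · simp [η, annularBump_eq_zero]
    · have hΔf := laplacian_radialExt_of_mem_eigenspace hf hx
      have hΔg := laplacian_radialExt_of_mem_eigenspace hg hx
      simp only [radialExt_mul, η, Complex.ofReal_mul]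
      linear_combination
        (annularBump (‖x‖ ^ 2) : ℂ) * (radialExt g x * hΔf - radialExt f x * hΔg)
  have hθ : (theta n k : ℂ) - theta n j ≠ 0 :=
    sub_ne_zero.2 fun h => hjk (theta_injective hn (Complex.ofReal_injective h)).symm
  rw [integral_congr_ae (.of_forall hintegrand), integral_const_mul,
    integral_radial_mul_radialExt hn (fun r => (annularBump (r ^ 2) : ℂ)) (f * g)] at hgreen
  have hσ : ∫ x, (f * g) x ∂(volume : Measure (EuclideanSpace ℂ (Fin n))).toSphere = 0 :=
    (mul_eq_zero.1 ((mul_eq_zero.1 hgreen).resolve_left hθ)).resolve_right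
      (integral_annularBump_volumeIoiPow_ne_zero hn)
  simp only [nu, integral_smul_measure, ← Pi.mul_apply, hσ, smul_zero]

end Sphere

/-! ### Zonal eigenfunctions -/

section Zonal

variable {E : Type*} [NormedAddCommGroup E] [InnerProductSpace ℝ E] {e x : E}

theorem hasFDerivAt_norm_inv (hx : x ≠ 0) :
    HasFDerivAt (fun y : E => ‖y‖⁻¹) (-(‖x‖⁻¹ ^ 3) • innerSL ℝ x) x := by
  have hnorm : ‖x‖ ≠ 0 := norm_ne_zero_iff.2 hx
  have hsqrt := ((hasStrictFDerivAt_norm_sq x).hasFDerivAt.sqrt (pow_ne_zero 2 hnorm))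
  simp only [Real.sqrt_sq (norm_nonneg _)] at hsqrt
  convert! (hasDerivAt_inv hnorm).comp_hasFDerivAt x hsqrt using 1
  ext v
  simp
  field_simp

theorem hasFDerivAt_inner_mul_norm_inv (e : E) (hx : x ≠ 0) :
    HasFDerivAt (fun y : E => inner ℝ e y * ‖y‖⁻¹)
      (‖x‖⁻¹ • innerSL ℝ e - (inner ℝ e x * ‖x‖⁻¹ ^ 3) • innerSL ℝ x) x := by
  convert! (innerSL ℝ e).hasFDerivAt.mul (hasFDerivAt_norm_inv hx) using 1
  ext v
  simp
  ring

/-- The function that is constant on rays and equals `p ⟪e, x⟫` on the unit sphere. -/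
def zonalFun (p : ℝ[X]) (e y : E) : ℝ := p.eval (inner ℝ e y * ‖y‖⁻¹)

theorem contDiffAt_zonalFun (p : ℝ[X]) (e : E) (hx : x ≠ 0) {m : WithTop ℕ∞} :
    ContDiffAt ℝ m (zonalFun p e) x := by
  have hp : ContDiff ℝ m fun t : ℝ => p.eval t := by simpa using p.contDiff_aeval (𝕜 := ℝ) m
  exact hp.contDiffAt.comp x ((contDiffAt_const.inner ℝ contDiffAt_id).mul
    ((contDiffAt_norm ℝ hx).inv (norm_ne_zero_iff.2 hx)))

theorem hasFDerivAt_zonalFun (p : ℝ[X]) (e : E) (hx : x ≠ 0) :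
    HasFDerivAt (zonalFun p e)
      (zonalFun (derivative p) e x •
        (‖x‖⁻¹ • innerSL ℝ e - (inner ℝ e x * ‖x‖⁻¹ ^ 3) • innerSL ℝ x)) x :=
  (p.hasDerivAt _).comp_hasFDerivAt x (hasFDerivAt_inner_mul_norm_inv e hx)

theorem fderiv_fderiv_zonalFun (p : ℝ[X]) (e : E) (hx : ‖x‖ = 1) {v : E} (hv : ‖v‖ = 1) :
    fderiv ℝ (fun y => fderiv ℝ (zonalFun p e) y v) x v =
      (derivative (derivative p)).eval (inner ℝ e x) *
        (inner ℝ e v - inner ℝ e x * inner ℝ x v) ^ 2 +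
      (derivative p).eval (inner ℝ e x) *
        (-2 * inner ℝ e v * inner ℝ x v - inner ℝ e x + 3 * inner ℝ e x * inner ℝ x v ^ 2) := by
  have hx0 : x ≠ 0 := norm_ne_zero_iff.1 (hx.trans_ne one_ne_zero)
  have hfirst : (fun y => fderiv ℝ (zonalFun p e) y v) =ᶠ[nhds x] fun y =>
      zonalFun (derivative p) e y *
        (‖y‖⁻¹ * inner ℝ e v - inner ℝ e y * ‖y‖⁻¹ ^ 3 * inner ℝ v y) := by
    filter_upwards [isOpen_compl_singleton.mem_nhds hx0] with y hy
    rw [(hasFDerivAt_zonalFun p e hy).fderiv]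
    simp [real_inner_comm]
  have hinv := hasFDerivAt_norm_inv hx0
  have hsecond := (hasFDerivAt_zonalFun (derivative p) e hx0).mul
    ((hinv.mul_const (inner ℝ e v)).sub
      (((innerSL ℝ e).hasFDerivAt.mul (hinv.pow 3)).mul (innerSL ℝ v).hasFDerivAt))
  rw [hfirst.fderiv_eq]
  refine (congrArg (fun L : E →L[ℝ] ℝ => L v) hsecond.fderiv).trans ?_
  simp [zonalFun, hx, hv, real_inner_comm x v]
  ring

theorem laplacian_zonalFun [FiniteDimensional ℝ E] (p : ℝ[X]) (he : ‖e‖ = 1) (hx : ‖x‖ = 1) :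
    Δ (zonalFun p e) x =
      (1 - inner ℝ e x ^ 2) * (derivative (derivative p)).eval (inner ℝ e x) -
        ((Module.finrank ℝ E : ℝ) - 1) * inner ℝ e x * (derivative p).eval (inner ℝ e x) := by
  set b := stdOrthonormalBasis ℝ E
  set t : ℝ := inner ℝ e x
  set p₁ := (derivative p).eval t
  set p₂ := (derivative (derivative p)).eval t
  have hee : ∑ i, inner ℝ e (b i) ^ 2 = (1 : ℝ) := by
    simpa [he, real_inner_comm] using b.sum_sq_inner_right e
  have hxx : ∑ i, inner ℝ x (b i) ^ 2 = (1 : ℝ) := by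
    simpa [hx, real_inner_comm] using b.sum_sq_inner_right x
  have hex : ∑ i, inner ℝ e (b i) * inner ℝ x (b i) = t := by
    simpa [real_inner_comm] using b.sum_inner_mul_inner e x
  have hx0 : x ≠ 0 := norm_ne_zero_iff.1 (hx.trans_ne one_ne_zero)
  calc Δ (zonalFun p e) x
      = ∑ i, (p₂ * (inner ℝ e (b i) - t * inner ℝ x (b i)) ^ 2 +
          p₁ * (-2 * inner ℝ e (b i) * inner ℝ x (b i) - t + 3 * t * inner ℝ x (b i) ^ 2)) := by
        rw [laplacian_eq_sum_fderiv (contDiffAt_zonalFun p e hx0) b]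
        exact sum_congr rfl fun i _ => fderiv_fderiv_zonalFun p e hx (b.norm_eq_one i)
    _ = ∑ i, (p₂ * inner ℝ e (b i) ^ 2 + (p₂ * t ^ 2 + 3 * t * p₁) * inner ℝ x (b i) ^ 2 -
          (2 * p₂ * t + 2 * p₁) * (inner ℝ e (b i) * inner ℝ x (b i)) - p₁ * t) :=
        sum_congr rfl fun i _ => by ring
    _ = _ := by
        rw [sum_sub_distrib, sum_sub_distrib, sum_add_distrib, ← mul_sum, ← mul_sum, ← mul_sum,
          hee, hxx, hex, sum_const, card_univ, Fintype.card_fin, nsmul_eq_mul]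
        ring

end Zonal

section ZonalSphere

variable {n : ℕ}

theorem re_herm (x e : CSphere n) :
    (herm x e).re = inner ℝ (e : EuclideanSpace ℂ (Fin n)) (x : EuclideanSpace ℂ (Fin n)) := by
  simp [herm, PiLp.inner_apply, Complex.inner]

theorem finrank_real_euclideanSpace (n : ℕ) :
    Module.finrank ℝ (EuclideanSpace ℂ (Fin n)) = 2 * n := by
  rw [← Module.finrank_mul_finrank ℝ ℂ]
  simp

theorem radialExt_zonal (p : ℝ[X]) (e : CSphere n) {x : EuclideanSpace ℂ (Fin n)} (hx : x ≠ 0) :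
    radialExt (fun x => ((p.eval (herm x e).re : ℝ) : ℂ)) x =
      Complex.ofRealCLM (zonalFun p (e : EuclideanSpace ℂ (Fin n)) x) := by
  simp only [radialExt, dif_neg hx, re_herm, inner_smul_right]
  rw [mul_comm]
  rfl

theorem zonal_mem_eigenspace {k : ℕ} {p : ℝ[X]}
    (hp : ∀ t : ℝ, (1 - t ^ 2) * (derivative (derivative p)).eval t -
      (2 * (n : ℝ) - 1) * t * (derivative p).eval t + theta n k * p.eval t = 0) (e : CSphere n) :
    (fun x => ((p.eval (herm x e).re : ℝ) : ℂ)) ∈ eigenspace n k := by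
  have hext (x : EuclideanSpace ℂ (Fin n)) (hx : x ≠ 0) :
      radialExt (fun x => ((p.eval (herm x e).re : ℝ) : ℂ)) =ᶠ[nhds x]
        Complex.ofRealCLM ∘ zonalFun p (e : EuclideanSpace ℂ (Fin n)) := by
    filter_upwards [isOpen_compl_singleton.mem_nhds hx] with y hy
    exact radialExt_zonal p e hy
  refine ⟨fun x hx => ?_, fun x => ?_⟩
  · refine ContDiffAt.contDiffWithinAt (ContDiffAt.congr_of_eventuallyEq ?_ (hext x hx))
    exact Complex.ofRealCLM.contDiff.contDiffAt.comp x (contDiffAt_zonalFun p _ hx)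
  · have hx := coe_csphere_ne_zero x
    rw [laplaceBeltrami, (InnerProductSpace.laplacian_congr_nhds (hext x hx)).self_of_nhds,
      (contDiffAt_zonalFun p _ hx).laplacian_CLM_comp_left, Function.comp_apply,
      laplacian_zonalFun p (norm_coe_csphere e) (norm_coe_csphere x), finrank_real_euclideanSpace,
      Complex.ofRealCLM_apply, ← Complex.ofReal_neg, ← Complex.ofReal_mul, Complex.ofReal_inj,
      re_herm]
    push_cast
    linarith [hp (inner ℝ (e : EuclideanSpace ℂ (Fin n)) (x : EuclideanSpace ℂ (Fin n)))]

theorem theta_eq (hn : 1 ≤ n) (k : ℕ) : theta n k = (k : ℝ) * (k + 2 * (n - 1 : ℕ)) := by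
  rw [theta, dim, Nat.cast_sub (by omega), Nat.cast_sub hn]
  push_cast
  ring

theorem zonalPoly_mem_eigenspace (hn : 1 ≤ n) (k : ℕ) (e : CSphere n) :
    (fun x => (((zonalPoly (n - 1) k).eval (herm x e).re : ℝ) : ℂ)) ∈ eigenspace n k := by
  refine zonal_mem_eigenspace (fun t => ?_) e
  have hode := congrArg (Polynomial.eval t) (zonalPoly_ode (n - 1) k)
  simp only [eval_add, eval_sub, eval_mul, eval_pow, eval_one, eval_X, eval_C, eval_zero,
    Nat.cast_sub hn, Nat.cast_one] at hode
  rw [theta_eq hn, Nat.cast_sub hn, Nat.cast_one]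
  linear_combination hode

end ZonalSphere

/-! ### The reproducing property -/

section Reproducing

variable {n : ℕ}

theorem continuous_re_herm (e : CSphere n) : Continuous fun x : CSphere n => (herm x e).re := by
  simp only [re_herm]
  fun_prop

theorem continuous_zonal (p : ℝ[X]) (e : CSphere n) :
    Continuous fun x : CSphere n => p.eval (herm x e).re :=
  p.continuous.comp (continuous_re_herm e)

theorem continuous_cesaroKernel (l m : ℕ) : Continuous (cesaroKernel l m) := by
  rw [funext (cesaroKernel_eq_sum l m)]
  fun_prop

theorem integrable_of_continuous (hn : 1 ≤ n) {F : Type*} [NormedAddCommGroup F]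
    {f : CSphere n → F} (hf : Continuous f) : Integrable f (nu n) := by
  have := isProbabilityMeasure_nu hn
  exact hf.integrable_of_hasCompactSupport (HasCompactSupport.of_compactSpace f)

theorem re_herm_comm (x e : CSphere n) : (herm x e).re = (herm e x).re := by
  rw [re_herm, re_herm, real_inner_comm]

theorem neg_one_le_re_herm (x e : CSphere n) : -1 ≤ (herm x e).re := by
  have h := abs_real_inner_le_norm (e : EuclideanSpace ℂ (Fin n)) (x : EuclideanSpace ℂ (Fin n))
  rw [norm_coe_csphere, norm_coe_csphere, mul_one, ← re_herm] at h
  exact (abs_le.1 h).1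

theorem dist_sq_eq (x e : CSphere n) : dist x e ^ 2 = 2 * (1 - (herm x e).re) := by
  rw [re_herm, Subtype.dist_eq, dist_eq_norm, norm_sub_sq_real, norm_coe_csphere, norm_coe_csphere,
    real_inner_comm]
  ring

theorem one_mem_eigenspace (n : ℕ) : (fun _ : CSphere n => (1 : ℂ)) ∈ eigenspace n 0 := by
  refine (isEmpty_or_nonempty (CSphere n)).elim (fun _ => ?_) fun ⟨e⟩ => ?_
  · convert! zero_mem (eigenspace n 0)
  · simpa using zonal_mem_eigenspace (k := 0) (p := 1) (fun t => by simp [theta]) e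

theorem re_herm_mem_eigenspace (hn : 1 ≤ n) (e : CSphere n) :
    (fun x : CSphere n => ((herm x e).re : ℂ)) ∈ eigenspace n 1 := by
  have hode (t : ℝ) : (1 - t ^ 2) * (derivative (derivative (X : ℝ[X]))).eval t -
      (2 * (n : ℝ) - 1) * t * (derivative X).eval t + theta n 1 * (X : ℝ[X]).eval t = 0 := by
    rw [theta_eq hn, Nat.cast_sub hn]
    simp
    ring
  simpa using zonal_mem_eigenspace hode e

theorem re_herm_sq_sub_mem_eigenspace (hn : 1 ≤ n) (e : CSphere n) :
    (fun x : CSphere n => (((herm x e).re ^ 2 - 1 / (2 * n) : ℝ) : ℂ)) ∈ eigenspace n 2 := by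
  set p : ℝ[X] := X ^ 2 - C (1 / (2 * (n : ℝ)))
  have hode (t : ℝ) : (1 - t ^ 2) * (derivative (derivative p)).eval t -
      (2 * (n : ℝ) - 1) * t * (derivative p).eval t + theta n 2 * p.eval t = 0 := by
    have hn0 : (n : ℝ) ≠ 0 := Nat.cast_ne_zero.2 (by omega)
    rw [theta_eq hn, Nat.cast_sub hn]
    simp [p, derivative_pow]
    field_simp
    ring
  simpa [p] using zonal_mem_eigenspace hode e

theorem integral_re_herm_sq (hn : 1 ≤ n) (e : CSphere n) :
    ∫ x, (herm x e).re ^ 2 ∂(nu n) = 1 / (2 * n) := by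
  have := isProbabilityMeasure_nu hn
  have hsq : Integrable (fun x : CSphere n => (herm x e).re ^ 2) (nu n) :=
    integrable_of_continuous hn ((continuous_re_herm e).pow 2)
  have horth := integral_mul_eq_zero_of_mem_eigenspace hn two_ne_zero
    (re_herm_sq_sub_mem_eigenspace hn e) (one_mem_eigenspace n)
  simp only [mul_one] at horth
  rw [integral_complex_ofReal, Complex.ofReal_eq_zero, integral_sub hsq (integrable_const _),
    integral_const, probReal_univ, one_smul, sub_eq_zero] at horth
  exact horth

theorem integral_mul_cesaroKernel (hn : 1 ≤ n) {k m : ℕ} (hkm : k ≤ m)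
    {f : CSphere n → ℂ} (hf : f ∈ eigenspace n k) (e : CSphere n) :
    ∫ x, f x * (cesaroKernel (n - 1) m (herm x e).re : ℂ) ∂(nu n) =
      ((dim n + (m - k)).choose (dim n) : ℂ) *
        ∫ x, f x * (((zonalPoly (n - 1) k).eval (herm x e).re : ℝ) : ℂ) ∂(nu n) := by
  have hd : 2 * (n - 1) + 1 = dim n := by rw [dim]; omega
  have hsum (x : CSphere n) : f x * (cesaroKernel (n - 1) m (herm x e).re : ℂ) =
      ∑ j ∈ range (m + 1), ((dim n + (m - j)).choose (dim n) : ℂ) *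
        (f x * (((zonalPoly (n - 1) j).eval (herm x e).re : ℝ) : ℂ)) := by
    rw [cesaroKernel_eq_sum, hd]
    push_cast
    rw [mul_sum]
    exact sum_congr rfl fun j _ => by ring
  have hint (j : ℕ) : Integrable
      (fun x => f x * (((zonalPoly (n - 1) j).eval (herm x e).re : ℝ) : ℂ)) (nu n) :=
    integrable_of_continuous hn
      (hf.1.continuous.mul (Complex.continuous_ofReal.comp (continuous_zonal _ e)))
  simp only [hsum]
  rw [integral_finsetSum _ fun j _ => (hint j).const_mul _]
  simp only [integral_const_mul]
  refine sum_eq_single_of_mem k (mem_range.2 (by omega)) fun j _ hj => ?_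
  rw [integral_mul_eq_zero_of_mem_eigenspace hn hj.symm hf (zonalPoly_mem_eigenspace hn j e),
    mul_zero]

theorem integral_cesaroKernel (hn : 1 ≤ n) (m : ℕ) (e : CSphere n) :
    ∫ x, cesaroKernel (n - 1) m (herm x e).re ∂(nu n) = ((dim n + m).choose (dim n) : ℝ) := by
  have := isProbabilityMeasure_nu hn
  have h := integral_mul_cesaroKernel hn (Nat.zero_le m) (one_mem_eigenspace n) e
  simp only [zonalPoly_zero, eval_one, Complex.ofReal_one, one_mul, mul_one, integral_const,
    probReal_univ, one_smul, Nat.sub_zero, integral_complex_ofReal] at h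
  exact_mod_cast h

theorem integral_re_herm_mul_cesaroKernel (hn : 1 ≤ n) (m : ℕ) (e : CSphere n) :
    ∫ x, (herm x e).re * cesaroKernel (n - 1) (m + 1) (herm x e).re ∂(nu n) =
      ((dim n + m).choose (dim n) : ℝ) := by
  have hn0 : (n : ℝ) ≠ 0 := Nat.cast_ne_zero.2 (by omega)
  have hlin (x : CSphere n) : (herm x e).re * (zonalPoly (n - 1) 1).eval (herm x e).re =
      2 * n * (herm x e).re ^ 2 := by
    rw [zonalPoly_one, Nat.cast_sub hn, eval_mul, eval_C, eval_X]
    ring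
  have h := integral_mul_cesaroKernel hn (Nat.le_add_left 1 m) (re_herm_mem_eigenspace hn e) e
  simp only [← Complex.ofReal_mul, hlin, integral_complex_ofReal, integral_const_mul,
    integral_re_herm_sq hn, Nat.add_sub_cancel, mul_one_div_cancel (mul_ne_zero two_ne_zero hn0),
    Complex.ofReal_one, mul_one] at h
  exact_mod_cast h

theorem exists_norm_sub_le {F : Type*} [NormedAddCommGroup F] {f : CSphere n → F}
    (hf : Continuous f) (e : CSphere n) {ε : ℝ} (hε : 0 < ε) :
    ∃ K : ℝ, ∀ x, ‖f x - f e‖ ≤ ε + K * (1 - (herm x e).re) := by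
  obtain ⟨δ, hδ, hnear⟩ := Metric.continuous_iff.1 hf e ε hε
  obtain ⟨B, hB⟩ := isCompact_univ.exists_bound_of_continuousOn (f := fun x => f x - f e)
    (hf.sub continuous_const).continuousOn
  have hB0 : 0 ≤ B := (norm_nonneg _).trans (hB e (Set.mem_univ e))
  refine ⟨2 * B / δ ^ 2, fun x => ?_⟩
  have hK : 2 * B / δ ^ 2 * (1 - (herm x e).re) = B * (dist x e ^ 2 / δ ^ 2) := by
    rw [dist_sq_eq]
    ring
  rw [hK]
  obtain hx | hx := lt_or_ge (dist x e) δ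
  · have hfx : ‖f x - f e‖ < ε := dist_eq_norm (f x) (f e) ▸ hnear x hx
    have : 0 ≤ B * (dist x e ^ 2 / δ ^ 2) := by positivity
    linarith
  · have hfar : B ≤ B * (dist x e ^ 2 / δ ^ 2) :=
      le_mul_of_one_le_right hB0 ((one_le_div (by positivity)).2 (by gcongr))
    linarith [hB x (Set.mem_univ x)]

theorem choose_div_choose_succ (d i : ℕ) :
    ((d + i).choose d : ℝ) / ((d + (i + 1)).choose d : ℝ) = 1 - d / ((i + (d + 1) : ℕ) : ℝ) := by
  have hrec := Nat.add_one_mul_choose_eq (d + i) i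
  rw [← Nat.choose_symm_add,
    ← Nat.choose_symm_of_eq_add (show d + i + 1 = d + (i + 1) by ring)] at hrec
  have hrec' : ((d : ℝ) + i + 1) * ((d + i).choose d : ℝ) =
      ((d + (i + 1)).choose d : ℝ) * (i + 1) := by exact_mod_cast hrec
  have hpos : 0 < ((d + (i + 1)).choose d : ℝ) := Nat.cast_pos.2 (Nat.choose_pos (by omega))
  push_cast
  field_simp
  linear_combination hrec'

theorem tendsto_choose_div_choose (d k : ℕ) :
    Filter.Tendsto (fun i : ℕ => ((d + i).choose d : ℝ) / ((d + (i + k)).choose d : ℝ))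
      Filter.atTop (nhds 1) := by
  have hne (i : ℕ) : ((d + i).choose d : ℝ) ≠ 0 :=
    Nat.cast_ne_zero.2 (Nat.choose_pos (by omega)).ne'
  have hstep : Filter.Tendsto (fun i : ℕ => ((d + i).choose d : ℝ) / ((d + (i + 1)).choose d : ℝ))
      Filter.atTop (nhds 1) := by
    simp only [choose_div_choose_succ]
    simpa using ((tendsto_const_div_atTop_nhds_zero_nat (d : ℝ)).comp
      (Filter.tendsto_add_atTop_nat (d + 1))).const_sub 1
  induction k with
  | zero => simp [hne]
  | succ k ih =>
    have hmul := ih.mul (hstep.comp (Filter.tendsto_add_atTop_nat k))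
    rw [mul_one] at hmul
    exact hmul.congr fun i => div_mul_div_cancel₀ (hne _)

theorem norm_integral_mul_cesaroKernel_sub_le (hn : 1 ≤ n) {f : CSphere n → ℂ}
    (hf : Continuous f) {e : CSphere n} {ε K : ℝ}
    (hK : ∀ x, ‖f x - f e‖ ≤ ε + K * (1 - (herm x e).re)) (m : ℕ) :
    ‖∫ x, f x * (cesaroKernel (n - 1) (m + 1) (herm x e).re : ℂ) ∂(nu n) -
        ((dim n + (m + 1)).choose (dim n) : ℝ) * f e‖ ≤
      ε * ((dim n + (m + 1)).choose (dim n) : ℝ) +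
        K * (((dim n + (m + 1)).choose (dim n) : ℝ) - ((dim n + m).choose (dim n) : ℝ)) := by
  set S : CSphere n → ℝ := fun x => cesaroKernel (n - 1) (m + 1) (herm x e).re
  have ht : Continuous fun x : CSphere n => (herm x e).re := continuous_re_herm e
  have hS : Continuous S := (continuous_cesaroKernel _ _).comp ht
  have hSC : Continuous fun x => (S x : ℂ) := Complex.continuous_ofReal.comp hS
  have hfS : Integrable (fun x => f x * (S x : ℂ)) (nu n) :=
    integrable_of_continuous hn (hf.mul hSC)
  have heS : Integrable (fun x => f e * (S x : ℂ)) (nu n) :=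
    integrable_of_continuous hn (continuous_const.mul hSC)
  have hS_int : Integrable (fun x => (ε + K) * S x) (nu n) :=
    integrable_of_continuous hn (continuous_const.mul hS)
  have htS : Integrable (fun x => K * ((herm x e).re * S x)) (nu n) :=
    integrable_of_continuous hn (continuous_const.mul (ht.mul hS))
  have hleft : ∫ x, f x * (S x : ℂ) ∂(nu n) - ((dim n + (m + 1)).choose (dim n) : ℝ) * f e =
      ∫ x, (f x - f e) * (S x : ℂ) ∂(nu n) := by
    simp only [sub_mul]
    rw [integral_sub hfS heS, integral_const_mul, integral_complex_ofReal,
      integral_cesaroKernel hn, mul_comm (f e)]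
  have hright : ∫ x, (ε + K * (1 - (herm x e).re)) * S x ∂(nu n) =
      ε * ((dim n + (m + 1)).choose (dim n) : ℝ) +
        K * (((dim n + (m + 1)).choose (dim n) : ℝ) - ((dim n + m).choose (dim n) : ℝ)) := by
    have hexp (x : CSphere n) : (ε + K * (1 - (herm x e).re)) * S x =
        (ε + K) * S x - K * ((herm x e).re * S x) := by ring
    simp only [hexp]
    rw [integral_sub hS_int htS, integral_const_mul, integral_const_mul,
      integral_cesaroKernel hn, integral_re_herm_mul_cesaroKernel hn]
    ring
  rw [hleft, ← hright]
  refine norm_integral_le_of_norm_le (integrable_of_continuous hn (by fun_prop))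
    (.of_forall fun x => ?_)
  have hS0 : 0 ≤ S x := cesaroKernel_nonneg _ _ (neg_one_le_re_herm x e)
  rw [norm_mul, Complex.norm_real, Real.norm_of_nonneg hS0]
  exact mul_le_mul_of_nonneg_right (hK x) hS0

theorem tendsto_integral_mul_cesaroKernel_div (hn : 1 ≤ n) {f : CSphere n → ℂ}
    (hf : Continuous f) (e : CSphere n) :
    Filter.Tendsto (fun m : ℕ => (∫ x, f x * (cesaroKernel (n - 1) m (herm x e).re : ℂ) ∂(nu n)) /
      (((dim n + m).choose (dim n) : ℝ) : ℂ)) Filter.atTop (nhds (f e)) := by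
  refine (Filter.tendsto_add_atTop_iff_nat 1).1 (Metric.tendsto_nhds.2 fun ε hε => ?_)
  obtain ⟨K, hK⟩ := exists_norm_sub_le hf e (half_pos hε)
  have hlim : Filter.Tendsto (fun m : ℕ => ε / 2 + K * (1 - ((dim n + m).choose (dim n) : ℝ) /
      ((dim n + (m + 1)).choose (dim n) : ℝ))) Filter.atTop (nhds (ε / 2)) := by
    simpa using (((tendsto_choose_div_choose (dim n) 1).const_sub 1).const_mul K).const_add (ε / 2)
  filter_upwards [hlim.eventually (gt_mem_nhds (half_lt_self hε))] with m hm
  refine lt_of_le_of_lt ?_ hm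
  have hpos : 0 < ((dim n + (m + 1)).choose (dim n) : ℝ) :=
    Nat.cast_pos.2 (Nat.choose_pos (by omega))
  have hne : (((dim n + (m + 1)).choose (dim n) : ℝ) : ℂ) ≠ 0 := Complex.ofReal_ne_zero.2 hpos.ne'
  rw [dist_eq_norm, div_sub' hne, norm_div, Complex.norm_real, Real.norm_of_nonneg hpos.le,
    div_le_iff₀ hpos]
  refine (norm_integral_mul_cesaroKernel_sub_le hn hf hK m).trans_eq ?_
  field_simp

theorem integral_mul_zonalPoly (hn : 1 ≤ n) {k : ℕ} {f : CSphere n → ℂ}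
    (hf : f ∈ eigenspace n k) (e : CSphere n) :
    ∫ x, f x * (((zonalPoly (n - 1) k).eval (herm x e).re : ℝ) : ℂ) ∂(nu n) = f e := by
  set I := ∫ x, f x * (((zonalPoly (n - 1) k).eval (herm x e).re : ℝ) : ℂ) ∂(nu n)
  have hmean := (tendsto_integral_mul_cesaroKernel_div hn hf.1.continuous e).comp
    (Filter.tendsto_add_atTop_nat k)
  have hI := ((Complex.continuous_ofReal.tendsto 1).comp
    (tendsto_choose_div_choose (dim n) k)).mul_const I
  rw [Complex.ofReal_one, one_mul] at hI
  refine tendsto_nhds_unique hI (hmean.congr fun i => ?_)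
  rw [Function.comp_apply, integral_mul_cesaroKernel hn (Nat.le_add_left k i) hf,
    Nat.add_sub_cancel, Function.comp_apply]
  push_cast
  ring

end Reproducing

/-! ### The de la Vallée Poussin kernels -/

section ValleePoussin

variable {n : ℕ}

/-- The profile of the reproducing kernel of the `k`-th eigenspace, a function of `⟨x, y⟩` that
depends only on the real part. -/
def reproducingProfile (n k : ℕ) (w : ℂ) : ℂ := (((zonalPoly (n - 1) k).eval w.re : ℝ) : ℂ)

theorem isReproducingKernel_reproducingProfile (hn : 1 ≤ n) (k : ℕ) :
    IsReproducingKernel (eigenspace n k) (invKernel (reproducingProfile n k)) := by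
  refine ⟨zonalPoly_mem_eigenspace hn k, fun f hf y => ?_⟩
  simp only [invKernel, reproducingProfile, Complex.conj_ofReal]
  exact (integral_mul_zonalPoly hn hf y).symm

theorem vpKernel_mem_polySpace (hn : 1 ≤ n) (a N : ℕ) (e : CSphere n) :
    (fun x => invKernel (vpKernel n (reproducingProfile n) a N) x e) ∈ polySpace n a (2 * N) := by
  have hsum : (fun x => invKernel (vpKernel n (reproducingProfile n) a N) x e) =
      ∑ k ∈ Icc a (2 * N), (cutoff (dim n) (dim n) ((k : ℝ) / (2 * (N : ℝ))) : ℂ) •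
        fun x => invKernel (reproducingProfile n k) x e := by
    funext x
    simp [invKernel, vpKernel]
  rw [hsum]
  exact Submodule.sum_mem _ fun k hk => Submodule.smul_mem _ _ <|
    Submodule.mem_iSup_of_mem k (Submodule.mem_iSup_of_mem hk (zonalPoly_mem_eigenspace hn k e))

theorem continuous_reproducingProfile (n k : ℕ) : Continuous (reproducingProfile n k) :=
  Complex.continuous_ofReal.comp ((zonalPoly (n - 1) k).continuous.comp Complex.continuous_re)

theorem continuous_vpKernel (n a N : ℕ) : Continuous (vpKernel n (reproducingProfile n) a N) := by
  have := continuous_reproducingProfile n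
  unfold vpKernel
  fun_prop

theorem continuous_herm : Continuous fun p : CSphere n × CSphere n => herm p.1 p.2 := by
  unfold herm
  fun_prop

theorem dim_pos (hn : 1 ≤ n) : 0 < dim n := by
  rw [dim]
  omega

theorem cutoff_div_two_mul_eq_one {d k N : ℕ} (hd : 0 < d) (hN : 1 ≤ N) (hk : k ≤ N) :
    cutoff d d (k / (2 * N)) = 1 := by
  have hN0 : (0 : ℝ) < N := Nat.cast_pos.2 hN
  have hkN : (k : ℝ) ≤ N := Nat.cast_le.2 hk
  refine (isSmoothCutoff_cutoff hd).eq_one _ ⟨by positivity, ?_⟩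
  rw [div_le_div_iff₀ (mul_pos two_pos hN0) two_pos]
  linarith

theorem conv_vpKernel_of_mem_eigenspace (hn : 1 ≤ n) {a N k : ℕ} (hN : 1 ≤ N)
    (hk : k ∈ Icc a N) {f : CSphere n → ℂ} (hf : f ∈ eigenspace n k) :
    conv (vpKernel n (reproducingProfile n) a N) f = f := by
  obtain ⟨hak, hkN⟩ := mem_Icc.1 hk
  funext x
  have hexpand (y : CSphere n) : f y * invKernel (vpKernel n (reproducingProfile n) a N) x y =
      ∑ j ∈ Icc a (2 * N), (cutoff (dim n) (dim n) ((j : ℝ) / (2 * (N : ℝ))) : ℂ) *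
        (f y * (((zonalPoly (n - 1) j).eval (herm y x).re : ℝ) : ℂ)) := by
    rw [invKernel, vpKernel, mul_sum]
    refine sum_congr rfl fun j _ => ?_
    rw [reproducingProfile, re_herm_comm]
    ring
  have hint (j : ℕ) : Integrable
      (fun y => f y * (((zonalPoly (n - 1) j).eval (herm y x).re : ℝ) : ℂ)) (nu n) :=
    integrable_of_continuous hn
      (hf.1.continuous.mul (Complex.continuous_ofReal.comp (continuous_zonal _ x)))
  simp only [conv, hexpand]
  rw [integral_finsetSum _ fun j _ => (hint j).const_mul _]
  simp only [integral_const_mul]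
  rw [sum_eq_single_of_mem k (mem_Icc.2 ⟨hak, by omega⟩), integral_mul_zonalPoly hn hf x,
    cutoff_div_two_mul_eq_one (dim_pos hn) hN hkN, Complex.ofReal_one, one_mul]
  intro j _ hj
  rw [integral_mul_eq_zero_of_mem_eigenspace hn hj.symm hf (zonalPoly_mem_eigenspace hn j x),
    mul_zero]

theorem conv_add (hn : 1 ≤ n) {Ψ : ℂ → ℂ} (hΨ : Continuous Ψ) {f g : CSphere n → ℂ}
    (hf : Continuous f) (hg : Continuous g) : conv Ψ (f + g) = conv Ψ f + conv Ψ g := by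
  funext x
  have hc : Continuous fun y => invKernel Ψ x y :=
    hΨ.comp (continuous_herm.comp (Continuous.prodMk_right x))
  simp only [conv, Pi.add_apply, add_mul]
  exact integral_add (integrable_of_continuous hn (hf.mul hc))
    (integrable_of_continuous hn (hg.mul hc))

theorem conv_smul (Ψ : ℂ → ℂ) (c : ℂ) (f : CSphere n → ℂ) : conv Ψ (c • f) = c • conv Ψ f := by
  funext x
  simp only [conv, Pi.smul_apply, smul_eq_mul, mul_assoc]
  exact integral_const_mul _ _

theorem conv_vpKernel (hn : 1 ≤ n) {a N : ℕ} (hN : 1 ≤ N) {t : CSphere n → ℂ}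
    (ht : t ∈ polySpace n a N) : conv (vpKernel n (reproducingProfile n) a N) t = t := by
  set Ψ := vpKernel n (reproducingProfile n) a N
  have hΨ : Continuous Ψ := continuous_vpKernel n a N
  let fixed : Submodule ℂ (CSphere n → ℂ) :=
    { carrier := {f | Continuous f ∧ conv Ψ f = f}
      zero_mem' := ⟨continuous_const, by funext x; simp [conv]⟩
      add_mem' := fun {f g} hf hg =>
        ⟨hf.1.add hg.1, by rw [conv_add hn hΨ hf.1 hg.1, hf.2, hg.2]⟩
      smul_mem' := fun c f hf => ⟨hf.1.const_smul c, by rw [conv_smul, hf.2]⟩ }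
  have hle : polySpace n a N ≤ fixed := iSup₂_le fun k hk f hf =>
    ⟨hf.1.continuous, conv_vpKernel_of_mem_eigenspace hn hN hk hf⟩
  exact (hle ht).2

theorem norm_vpKernel_le (hn : 1 ≤ n) {a N : ℕ} (ha : a = 0 ∨ a = 1) (hN : 1 ≤ N) {w : ℂ}
    (hw : -1 ≤ w.re) :
    ‖vpKernel n (reproducingProfile n) a N w‖ ≤ ∑ k ∈ range (2 * N + 1),
      |(fwdDiff 1)^[dim n + 1] (fun k : ℕ => cutoff (dim n) (dim n) (k / (2 * N))) k| *
        cesaroKernel (n - 1) k w.re + 1 := by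
  have hd := dim_pos hn
  have hdim : 2 * (n - 1) + 2 = dim n + 1 := by
    rw [dim]
    omega
  have hN0 : (0 : ℝ) < N := Nat.cast_pos.2 hN
  set g : ℕ → ℝ := fun k => cutoff (dim n) (dim n) (k / (2 * N)) with hg
  have hg0 (k : ℕ) (hk : 2 * N + 1 ≤ k) : g k = 0 := by
    have hNk : (2 * N : ℝ) ≤ k := by exact_mod_cast Nat.le_of_succ_le hk
    exact cutoff_eq_zero _ hd.ne' ((one_le_div (mul_pos two_pos hN0)).2 hNk)
  have hg_zero : g 0 = 1 := cutoff_div_two_mul_eq_one hd hN N.zero_le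
  have hfull := abs_sum_mul_zonalPoly_le (n - 1) hg0 hw
  rw [hdim] at hfull
  have hreal : vpKernel n (reproducingProfile n) a N w =
      ((∑ k ∈ Icc a (2 * N), g k * (zonalPoly (n - 1) k).eval w.re : ℝ) : ℂ) := by
    simp [vpKernel, reproducingProfile, hg]
  rw [hreal, Complex.norm_real, Real.norm_eq_abs]
  rw [Nat.range_succ_eq_Icc_zero] at hfull ⊢
  obtain rfl | rfl := ha
  · exact hfull.trans (le_add_of_nonneg_right zero_le_one)
  · rw [← sum_Ioc_add_eq_sum_Icc (Nat.zero_le _), zonalPoly_zero, eval_one, mul_one, hg_zero,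
      ← Icc_add_one_left_eq_Ioc, zero_add] at hfull
    set s := ∑ k ∈ Icc 1 (2 * N), g k * (zonalPoly (n - 1) k).eval w.re
    have hs : |s| ≤ |s + 1| + 1 := by simpa using abs_sub (s + 1) 1
    exact hs.trans (add_le_add_left hfull 1)

theorem exists_eLpNorm_vpKernel_le (hn : 1 ≤ n) :
    ∃ C : ℝ≥0, ∀ a : ℕ, a = 0 ∨ a = 1 → ∀ N : ℕ, 1 ≤ N → ∀ e : CSphere n,
      eLpNorm (fun x => invKernel (vpKernel n (reproducingProfile n) a N) x e) 1 (nu n) ≤ C := by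
  have := isProbabilityMeasure_nu hn
  refine ⟨(4 * dim n * (dim n + 1)) ^ dim n + 1, fun a ha N hN e => ?_⟩
  have hQ : Integrable (fun x => invKernel (vpKernel n (reproducingProfile n) a N) x e) (nu n) :=
    integrable_of_continuous hn ((continuous_vpKernel n a N).comp
      (continuous_herm.comp (Continuous.prodMk_left e)))
  set D : ℕ → ℝ := fun k =>
    |(fwdDiff 1)^[dim n + 1] (fun k : ℕ => cutoff (dim n) (dim n) (k / (2 * N))) k|
  have hS (k : ℕ) : Integrable (fun x => D k * cesaroKernel (n - 1) k (herm x e).re) (nu n) :=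
    integrable_of_continuous hn
      (continuous_const.mul ((continuous_cesaroKernel _ k).comp (continuous_re_herm e)))
  have hsum := integrable_finsetSum (range (2 * N + 1)) fun k _ => hS k
  have hvar := sum_abs_fwdDiff_cutoff_div_mul_choose_le (dim n) (R := 2 * N) (by omega)
  push_cast at hvar
  rw [eLpNorm_one_eq_lintegral_enorm, ← ofReal_integral_norm_eq_lintegral_enorm hQ,
    ← ENNReal.ofReal_coe_nnreal]
  refine ENNReal.ofReal_le_ofReal ?_
  calc ∫ x, ‖invKernel (vpKernel n (reproducingProfile n) a N) x e‖ ∂(nu n)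
      ≤ ∫ x, (∑ k ∈ range (2 * N + 1), D k * cesaroKernel (n - 1) k (herm x e).re + 1) ∂(nu n) :=
        integral_mono hQ.norm (hsum.add (integrable_const _)) fun x =>
          norm_vpKernel_le hn ha hN (neg_one_le_re_herm x e)
    _ = ∑ k ∈ range (2 * N + 1), D k * ((dim n + k).choose (dim n) : ℝ) + 1 := by
        rw [integral_add hsum (integrable_const _), integral_finsetSum _ fun k _ => hS k,
          integral_const, probReal_univ, one_smul]
        simp only [integral_const_mul, integral_cesaroKernel hn]
    _ ≤ (((4 * dim n * (dim n + 1)) ^ dim n + 1 : ℝ≥0) : ℝ) := by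
        push_cast
        exact add_le_add_left hvar 1

end ValleePoussin

end ComplexSphere

end

/-- On the unit sphere of `ℂⁿ` (real dimension `d = 2 * n - 1`): the function `χ_d` is a smooth
piecewise polynomial cutoff, the eigenspaces `H_k` of the Laplace-Beltrami operator have unitarily
invariant reproducing kernels `M_k`, and the kernels `Q_{2N} = ∑ k ∈ [a, 2N], χ_d (k / (2N)) M_k`
belong to `T_{2N} = lin {H_k : a ≤ k ≤ 2N}`, reproduce `T_N` by convolution, and are bounded in
`L₁` uniformly in `N`; here `a = 0` or `a = 1` according to whether constants are
included or not. -/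
theorem lemma1 (n : ℕ) (hn : 1 ≤ n) :
    ComplexSphere.IsSmoothCutoff (ComplexSphere.dim n)
      (ComplexSphere.cutoff (ComplexSphere.dim n) (ComplexSphere.dim n)) ∧
    ∃ M : ℕ → ℂ → ℂ,
      (∀ k, ComplexSphere.IsReproducingKernel (ComplexSphere.eigenspace n k)
        (ComplexSphere.invKernel (M k))) ∧
      ∃ C : ℝ≥0, ∀ a ∈ ({0, 1} : Set ℕ), ∀ N : ℕ, 1 ≤ N →
        (∀ e : ComplexSphere.CSphere n,
          (fun x => ComplexSphere.invKernel (ComplexSphere.vpKernel n M a N) x e) ∈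
            ComplexSphere.polySpace n a (2 * N)) ∧
        (∀ t ∈ ComplexSphere.polySpace n a N,
          ComplexSphere.conv (ComplexSphere.vpKernel n M a N) t = t) ∧
        (∀ e : ComplexSphere.CSphere n,
          eLpNorm (fun x => ComplexSphere.invKernel (ComplexSphere.vpKernel n M a N) x e) 1
            (ComplexSphere.nu n) ≤ C) := by
  obtain ⟨C, hC⟩ := ComplexSphere.exists_eLpNorm_vpKernel_le hn
  refine ⟨ComplexSphere.isSmoothCutoff_cutoff (ComplexSphere.dim_pos hn),
    ComplexSphere.reproducingProfile n, ComplexSphere.isReproducingKernel_reproducingProfile hn,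
    C, fun a ha N hN => ⟨ComplexSphere.vpKernel_mem_polySpace hn a N,
      fun t ht => ComplexSphere.conv_vpKernel hn hN ht, hC a (by simpa using ha) N hN⟩⟩
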